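/- Let $(M,\varphi,\xi,\eta,g)$ be a Sasakian manifold, that is, a smooth manifold with a Riemannian metric $g$, a smooth $(1,1)$-tensor field $\varphi$, a smooth vector field $\xi$ and a smooth 1-form $\eta$ such that $$\varphi\xi=0,\quad \eta(\xi)=1,\quad \varphi^2=-I+\eta\otimes\xi,\quad g(\varphi E,\varphi F)=g(E,F)-\eta(E)\eta(F),$$ $$d\eta(E,F)=g(E,\varphi F),\qquad [\varphi,\varphi]+2\,d\eta\otimes\xi=0,$$ where $2\,d\eta(E,F)=E\,\eta(F)-F\,\eta(E)-\eta([E,F])$ and $[\varphi,\varphi]$ is the Nijenhuis tensor of $\varphi$. Let $\pi:(M,g)\to(N,g_N)$ be a Riemannian submersion: a smooth surjective map of rank $\dim N$ at every point, with $\dim M>\dim N$, such that $g_N(\pi_*Y,\pi_*Z)=g(Y,Z)$ for all horizontal $Y,Z$, i.e. all $Y,Z\in(\ker\pi_*)^\perp$. Suppose that $\pi$ is anti-invariant, $\varphi(\ker\pi_*)\subseteq(\ker\pi_*)^{\perp}$, and that the Reeb vector field $\xi$ is horizontal. Let $\mathcal V$ and $\mathcal H$ denote the orthogonal projections onto $\ker\pi_*$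 and $(\ker\pi_*)^\perp$, let $\nabla$ be the Levi-Civita connection of $g$, let $$\mathcal T_EF=\mathcal V\nabla_{\mathcal VE}\mathcal HF+\mathcal H\nabla_{\mathcal VE}\mathcal VF,\qquad \mathcal A_EF=\mathcal V\nabla_{\mathcal HE}\mathcal HF+\mathcal H\nabla_{\mathcal HE}\mathcal VF$$ be O'Neill's tensors, and for horizontal $Y$ write $\varphi Y=\mathcal BY+\mathcal CY$ with $\mathcal BY$ vertical and $\mathcal CY$ horizontal. Let $f:M\to\mathbb R$ be a smooth function with gradient $\nabla f$. Then the following are equivalent. 1. $\pi$ is a Clairaut submersion with $r=e^f$: for every geodesic $\alpha$ of $M$ (defined on an open interval) the function $t\mapsto e^{f(\alpha(t))}\sin\theta(t)$ is constant, where $\theta(t)$ is the angle between $\dot\alpha(t)$ and the horizontal space at $\alpha(t)$. 2. For every geodesic $\alpha$ of $M$, with $V=\mathcal V\dot\alpha$ and $X=\mathcal H\dot\alpha$, one has along $\alpha$ $$g(\nabla f,X)\,\|V\|^2=g\big(\eta(X)X+\mathcal H\nabla_{\dot\alpha}\mathcal CX+(\mathcal T_V+\mathcal A_X)\mathcal BX,\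 \varphi V\big).$$ -/

import Mathlib

open Bundle NormedSpace FiberBundle VectorField
open scoped Manifold ContDiff

noncomputable section

namespace ClairautSubmersion

section LeviCivita

variable {E : Type*} [NormedAddCommGroup E] [NormedSpace ℝ E] [FiniteDimensional ℝ E]
  {M : Type*} [TopologicalSpace M] [ChartedSpace E M] [IsManifold 𝓘(ℝ, E) ∞ M]
  [RiemannianBundle (fun x : M ↦ TangentSpace 𝓘(ℝ, E) x)]

instance instFiniteDimensionalTangentSpace (p : M) :
    FiniteDimensional ℝ (TangentSpace 𝓘(ℝ, E) p) :=
  inferInstanceAs (FiniteDimensional ℝ E)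

instance instCompleteTangentSpace (p : M) : CompleteSpace (TangentSpace 𝓘(ℝ, E) p) :=
  FiniteDimensional.complete ℝ _

/-- Half of the right-hand side of the Koszul formula at `p`, that is
`½ (X g(Y,Z) + Y g(X,Z) - Z g(X,Y) + g([X,Y],Z) - g([X,Z],Y) - g([Y,Z],X))`. -/
def koszul (Y X Z : Π x : M, TangentSpace 𝓘(ℝ, E) x) (p : M) : ℝ :=
  (1 / 2 : ℝ) *
    (mvfderiv 𝓘(ℝ, E) (fun x ↦ inner ℝ (Y x) (Z x)) p (X p)
      + mvfderiv 𝓘(ℝ, E) (fun x ↦ inner ℝ (X x) (Z x)) p (Y p)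
      - mvfderiv 𝓘(ℝ, E) (fun x ↦ inner ℝ (X x) (Y x)) p (Z p)
      + inner ℝ (mlieBracket 𝓘(ℝ, E) X Y p) (Z p)
      - inner ℝ (mlieBracket 𝓘(ℝ, E) X Z p) (Y p)
      - inner ℝ (mlieBracket 𝓘(ℝ, E) Y Z p) (X p))

variable [IsContMDiffRiemannianBundle 𝓘(ℝ, E) ∞ E (fun x : M ↦ TangentSpace 𝓘(ℝ, E) x)]

theorem mdifferentiableAt_inner {Y Z : Π x : M, TangentSpace 𝓘(ℝ, E) x} {p : M}
    (hY : MDiffAt (T% Y) p) (hZ : MDiffAt (T% Z) p) :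
    MDiffAt (fun x ↦ inner ℝ (Y x) (Z x)) p :=
  MDifferentiableAt.inner_bundle (E := fun x : M ↦ TangentSpace 𝓘(ℝ, E) x) hY hZ

theorem koszul_tensorial_left {Y Z : Π x : M, TangentSpace 𝓘(ℝ, E) x} {p : M}
    (hY : MDiffAt (T% Y) p) (hZ : MDiffAt (T% Z) p) :
    TensorialAt 𝓘(ℝ, E) E (fun X ↦ koszul Y X Z p) p where
  smul {f X} hf hX := by
    have h1 : mvfderiv 𝓘(ℝ, E) (fun x ↦ inner ℝ ((f • X) x) (Z x)) p
        = mvfderiv 𝓘(ℝ, E) (f * fun x ↦ inner ℝ (X x) (Z x)) p := by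
      congr 1; ext x; simp [inner_smul_left]
    have h2 : mvfderiv 𝓘(ℝ, E) (fun x ↦ inner ℝ ((f • X) x) (Y x)) p
        = mvfderiv 𝓘(ℝ, E) (f * fun x ↦ inner ℝ (X x) (Y x)) p := by
      congr 1; ext x; simp [inner_smul_left]
    simp only [koszul, h1, h2, mvfderiv_mul hf (mdifferentiableAt_inner hX hZ),
      mvfderiv_mul hf (mdifferentiableAt_inner hX hY), mlieBracket_smul_left hf hX]
    rw [inner_add_left, inner_add_left]
    simp [inner_smul_right, real_inner_comm (Y p), real_inner_comm (Z p)]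
    ring
  add {X X'} hX hX' := by
    have h1 : mvfderiv 𝓘(ℝ, E) (fun x ↦ inner ℝ ((X + X') x) (Z x)) p
        = mvfderiv 𝓘(ℝ, E) ((fun x ↦ inner ℝ (X x) (Z x)) + fun x ↦ inner ℝ (X' x) (Z x)) p := by
      congr 1; ext x; simp [inner_add_left]
    have h2 : mvfderiv 𝓘(ℝ, E) (fun x ↦ inner ℝ ((X + X') x) (Y x)) p
        = mvfderiv 𝓘(ℝ, E) ((fun x ↦ inner ℝ (X x) (Y x)) + fun x ↦ inner ℝ (X' x) (Y x)) p := by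
      congr 1; ext x; simp [inner_add_left]
    simp only [koszul, h1, h2, mvfderiv_add (mdifferentiableAt_inner hX hZ) (mdifferentiableAt_inner hX' hZ),
      mvfderiv_add (mdifferentiableAt_inner hX hY) (mdifferentiableAt_inner hX' hY), mlieBracket_add_left hX hX']
    simp [inner_add_left, inner_add_right]
    ring

theorem koszul_tensorial_right {Y X : Π x : M, TangentSpace 𝓘(ℝ, E) x} {p : M}
    (hY : MDiffAt (T% Y) p) (hX : MDiffAt (T% X) p) :
    TensorialAt 𝓘(ℝ, E) E (fun Z ↦ koszul Y X Z p) p where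
  smul {f Z} hf hZ := by
    have h1 : mvfderiv 𝓘(ℝ, E) (fun x ↦ inner ℝ (Y x) ((f • Z) x)) p
        = mvfderiv 𝓘(ℝ, E) (f * fun x ↦ inner ℝ (Y x) (Z x)) p := by
      congr 1; ext x; simp [inner_smul_right]
    have h2 : mvfderiv 𝓘(ℝ, E) (fun x ↦ inner ℝ (X x) ((f • Z) x)) p
        = mvfderiv 𝓘(ℝ, E) (f * fun x ↦ inner ℝ (X x) (Z x)) p := by
      congr 1; ext x; simp [inner_smul_right]
    simp only [koszul, h1, h2, mvfderiv_mul hf (mdifferentiableAt_inner hY hZ),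
      mvfderiv_mul hf (mdifferentiableAt_inner hX hZ), mlieBracket_smul_right hf hZ]
    rw [inner_add_left, inner_add_left]
    simp only [Pi.smul_apply', real_inner_smul_left, real_inner_smul_right,
      map_smul, smul_eq_mul, _root_.add_apply, _root_.smul_apply,
      real_inner_comm (Y p) (Z p), real_inner_comm (X p) (Z p)]
    ring
  add {Z Z'} hZ hZ' := by
    have h1 : mvfderiv 𝓘(ℝ, E) (fun x ↦ inner ℝ (Y x) ((Z + Z') x)) p
        = mvfderiv 𝓘(ℝ, E) ((fun x ↦ inner ℝ (Y x) (Z x)) + fun x ↦ inner ℝ (Y x) (Z' x)) p := by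
      congr 1; ext x; simp [inner_add_right]
    have h2 : mvfderiv 𝓘(ℝ, E) (fun x ↦ inner ℝ (X x) ((Z + Z') x)) p
        = mvfderiv 𝓘(ℝ, E) ((fun x ↦ inner ℝ (X x) (Z x)) + fun x ↦ inner ℝ (X x) (Z' x)) p := by
      congr 1; ext x; simp [inner_add_right]
    simp only [koszul, h1, h2, mvfderiv_add (mdifferentiableAt_inner hY hZ) (mdifferentiableAt_inner hY hZ'),
      mvfderiv_add (mdifferentiableAt_inner hX hZ) (mdifferentiableAt_inner hX hZ'), mlieBracket_add_right hZ hZ']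
    simp [inner_add_left, inner_add_right]
    ring

open Classical in
/-- The bilinear form `(u, w) ↦ g(∇_u Y, w)` on `T_pM` given by the Koszul formula
(zero if `Y` is not differentiable at `p`). -/
def koszulForm (Y : Π x : M, TangentSpace 𝓘(ℝ, E) x) (p : M) :
    TangentSpace 𝓘(ℝ, E) p →L[ℝ] TangentSpace 𝓘(ℝ, E) p →L[ℝ] ℝ :=
  if hY : MDiffAt (T% Y) p then
    TensorialAt.mkHom₂ (fun X Z ↦ koszul Y X Z p) p
      (fun _ hZ ↦ koszul_tensorial_left hY hZ) (fun _ hX ↦ koszul_tensorial_right hY hX)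
  else 0

theorem koszulForm_apply {Y X Z : Π x : M, TangentSpace 𝓘(ℝ, E) x} {p : M}
    (hY : MDiffAt (T% Y) p) (hX : MDiffAt (T% X) p) (hZ : MDiffAt (T% Z) p) :
    koszulForm Y p (X p) (Z p) = koszul Y X Z p := by
  rw [koszulForm, dif_pos hY]
  exact TensorialAt.mkHom₂_apply _ _ hX hZ

/-- The Levi-Civita covariant derivative `u ↦ ∇_u Y` on `T_pM`: the vector `∇_u Y` represents the
linear form `w ↦ g(∇_u Y, w)` of the Koszul formula. -/
def leviCivitaFun (Y : Π x : M, TangentSpace 𝓘(ℝ, E) x) (p : M) :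
    TangentSpace 𝓘(ℝ, E) p →L[ℝ] TangentSpace 𝓘(ℝ, E) p :=
  LinearMap.toContinuousLinearMap
    { toFun := fun u ↦
        (InnerProductSpace.toDual ℝ (TangentSpace 𝓘(ℝ, E) p)).symm (koszulForm Y p u)
      map_add' := fun u v ↦ by simp
      map_smul' := fun c u ↦ by simp }

theorem inner_leviCivitaFun {Y X Z : Π x : M, TangentSpace 𝓘(ℝ, E) x} {p : M}
    (hY : MDiffAt (T% Y) p) (hX : MDiffAt (T% X) p) (hZ : MDiffAt (T% Z) p) :
    inner ℝ (leviCivitaFun Y p (X p)) (Z p) = koszul Y X Z p := by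
  rw [← koszulForm_apply hY hX hZ]
  simp [leviCivitaFun]

theorem leviCivitaFun_eq {Y : Π x : M, TangentSpace 𝓘(ℝ, E) x} {p : M}
    (hY : MDiffAt (T% Y) p) (u v : TangentSpace 𝓘(ℝ, E) p)
    (h : ∀ X Z : Π x : M, TangentSpace 𝓘(ℝ, E) x, MDiffAt (T% X) p → MDiffAt (T% Z) p →
      X p = u → koszul Y X Z p = inner ℝ v (Z p)) :
    leviCivitaFun Y p u = v := by
  refine ext_inner_right ℝ fun w ↦ ?_
  have hX := mdifferentiableAt_extend 𝓘(ℝ, E) E u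
  have hZ := mdifferentiableAt_extend 𝓘(ℝ, E) E w
  have h1 := inner_leviCivitaFun hY hX hZ
  rw [h _ _ hX hZ (extend_apply_self ..), extend_apply_self, extend_apply_self] at h1
  exact h1

variable (E M) in
/-- The Levi-Civita connection of the Riemannian manifold `M`. -/
def leviCivita :
    CovariantDerivative 𝓘(ℝ, E) E (TangentSpace 𝓘(ℝ, E) : M → Type _) where
  toFun := leviCivitaFun
  isCovariantDerivativeOnUniv :=
    { add := by
        intro Y Y' p hY hY' _
        ext u
        refine leviCivitaFun_eq (mdifferentiableAt_add_section hY hY') u _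
          fun X Z hX hZ hXu ↦ ?_
        rw [_root_.add_apply, inner_add_left, ← hXu, inner_leviCivitaFun hY hX hZ,
          inner_leviCivitaFun hY' hX hZ]
        have h1 : mvfderiv 𝓘(ℝ, E) (fun x ↦ inner ℝ ((Y + Y') x) (Z x)) p
            = mvfderiv 𝓘(ℝ, E)
              ((fun x ↦ inner ℝ (Y x) (Z x)) + fun x ↦ inner ℝ (Y' x) (Z x)) p := by
          congr 1; ext x; simp [inner_add_left]
        have h2 : mvfderiv 𝓘(ℝ, E) (fun x ↦ inner ℝ (X x) ((Y + Y') x)) p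
            = mvfderiv 𝓘(ℝ, E)
              ((fun x ↦ inner ℝ (X x) (Y x)) + fun x ↦ inner ℝ (X x) (Y' x)) p := by
          congr 1; ext x; simp [inner_add_right]
        simp only [koszul, h1, h2,
          mvfderiv_add (mdifferentiableAt_inner hY hZ) (mdifferentiableAt_inner hY' hZ),
          mvfderiv_add (mdifferentiableAt_inner hX hY) (mdifferentiableAt_inner hX hY'),
          mlieBracket_add_right hY hY', mlieBracket_add_left hY hY']
        simp [inner_add_left, inner_add_right]
        ring
      leibniz := by
        intro Y f p hY hf _
        ext u
        refine leviCivitaFun_eq (hf.smul_section hY) u _ fun X Z hX hZ hXu ↦ ?_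
        rw [_root_.add_apply, inner_add_left, _root_.smul_apply,
          real_inner_smul_left, ← hXu, inner_leviCivitaFun hY hX hZ,
          ContinuousLinearMap.smulRight_apply, real_inner_smul_left]
        have h1 : mvfderiv 𝓘(ℝ, E) (fun x ↦ inner ℝ ((f • Y) x) (Z x)) p
            = mvfderiv 𝓘(ℝ, E) (f * fun x ↦ inner ℝ (Y x) (Z x)) p := by
          congr 1; ext x; simp [inner_smul_left]
        have h2 : mvfderiv 𝓘(ℝ, E) (fun x ↦ inner ℝ (X x) ((f • Y) x)) p
            = mvfderiv 𝓘(ℝ, E) (f * fun x ↦ inner ℝ (X x) (Y x)) p := by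
          congr 1; ext x; simp [inner_smul_right]
        simp only [koszul, h1, h2, mvfderiv_mul hf (mdifferentiableAt_inner hY hZ),
          mvfderiv_mul hf (mdifferentiableAt_inner hX hY), mlieBracket_smul_right hf hY,
          mlieBracket_smul_left hf hY]
        rw [inner_add_left, inner_add_left]
        simp only [Pi.smul_apply', real_inner_smul_left, real_inner_smul_right,
          map_smul, smul_eq_mul, _root_.add_apply, _root_.smul_apply,
          real_inner_comm (X p) (Y p), neg_smul, inner_neg_left]
        ring }

theorem leviCivita_torsion_eq_zero : (leviCivita E M).torsion = 0 := by
  rw [CovariantDerivative.torsion_eq_zero_iff]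
  intro X Y p hX hY
  refine ext_inner_right ℝ fun w ↦ ?_
  have hZ := mdifferentiableAt_extend 𝓘(ℝ, E) E w
  have h1 := inner_leviCivitaFun hY hX hZ
  have h2 := inner_leviCivitaFun hX hY hZ
  rw [extend_apply_self] at h1 h2
  rw [inner_sub_left]
  have h3 : (fun x ↦ inner ℝ (X x) (Y x)) = fun x ↦ inner ℝ (Y x) (X x) := by
    ext x; exact real_inner_comm _ _
  have h4 : mlieBracket 𝓘(ℝ, E) Y X p = - mlieBracket 𝓘(ℝ, E) X Y p := mlieBracket_swap_apply
  refine (congrArg₂ (· - ·) h1 h2).trans ?_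
  simp only [koszul, extend_apply_self, h3, h4, inner_neg_left]
  ring

theorem leviCivita_inner {X Y Z : Π x : M, TangentSpace 𝓘(ℝ, E) x} {p : M}
    (hX : MDiffAt (T% X) p) (hY : MDiffAt (T% Y) p) (hZ : MDiffAt (T% Z) p) :
    mvfderiv 𝓘(ℝ, E) (fun x ↦ inner ℝ (Y x) (Z x)) p (X p)
      = inner ℝ (leviCivita E M Y p (X p)) (Z p) + inner ℝ (Y p) (leviCivita E M Z p (X p)) := by
  have h1 := inner_leviCivitaFun hY hX hZ
  have h2 := inner_leviCivitaFun hZ hX hY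
  have h3 : (fun x ↦ inner ℝ (Z x) (Y x)) = fun x ↦ inner ℝ (Y x) (Z x) := by
    ext x; exact real_inner_comm _ _
  have h4 : mlieBracket 𝓘(ℝ, E) Z Y p = - mlieBracket 𝓘(ℝ, E) Y Z p := mlieBracket_swap_apply
  rw [real_inner_comm _ (Y p)]
  refine Eq.symm ((congrArg₂ (· + ·) h1 h2).trans ?_)
  simp only [koszul, h3, h4, inner_neg_left]
  ring

end LeviCivita

section Curves

variable {E : Type*} [NormedAddCommGroup E] [NormedSpace ℝ E] [FiniteDimensional ℝ E]
  {M : Type*} [TopologicalSpace M] [ChartedSpace E M] [IsManifold 𝓘(ℝ, E) ∞ M]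
  [RiemannianBundle (fun x : M ↦ TangentSpace 𝓘(ℝ, E) x)]
  [IsContMDiffRiemannianBundle 𝓘(ℝ, E) ∞ E (fun x : M ↦ TangentSpace 𝓘(ℝ, E) x)]

/-- The gradient of a function: `g(∇f, v) = df(v)`. -/
def grad (f : M → ℝ) (p : M) : TangentSpace 𝓘(ℝ, E) p :=
  (InnerProductSpace.toDual ℝ (TangentSpace 𝓘(ℝ, E) p)).symm (mvfderiv 𝓘(ℝ, E) f p)

variable (E) in
/-- The velocity field `α̇` of a curve. -/
def velocity (α : ℝ → M) (t : ℝ) : TangentSpace 𝓘(ℝ, E) (α t) :=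
  mfderiv 𝓘(ℝ, ℝ) 𝓘(ℝ, E) α t (1 : ℝ)

/-- The covariant derivative `∇_α̇ W` along a curve `α` of a vector field `W` along `α`. In the
trivialization `e` of the tangent bundle by the chart at `α t`, it is `dW/dt + Γ(α̇, W)`:
the first summand differentiates the components of `W`, the second is the derivative of the local
vector field whose components in `e` are constant, equal to those of `W t`. -/
def covDerivAlong (α : ℝ → M) (W : Π t : ℝ, TangentSpace 𝓘(ℝ, E) (α t)) (t : ℝ) :
    TangentSpace 𝓘(ℝ, E) (α t) :=
  let e := trivializationAt E (TangentSpace 𝓘(ℝ, E) : M → Type _) (α t)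
  e.symm (α t) (deriv (fun s ↦ (e ⟨α s, W s⟩).2) t)
    + leviCivita E M (extend E (W t)) (α t) (velocity E α t)

variable (E) in
/-- `α` is a geodesic on the open interval `J`: `∇_α̇ α̇ = 0`. (A `C^2` solution of this equation
is automatically smooth.) -/
structure IsGeodesicOn (α : ℝ → M) (J : Set ℝ) : Prop where
  isOpen : IsOpen J
  ordConnected : J.OrdConnected
  contMDiffOn : ContMDiffOn 𝓘(ℝ, ℝ) 𝓘(ℝ, E) 2 α J
  covDeriv_velocity : ∀ t ∈ J, covDerivAlong α (velocity E α) t = 0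

end Curves

section Contact

variable {E : Type*} [NormedAddCommGroup E] [NormedSpace ℝ E]
  {M : Type*} [TopologicalSpace M] [ChartedSpace E M] [IsManifold 𝓘(ℝ, E) ∞ M]

/-- The exterior derivative of a one-form evaluated on two vector fields, normalised as in contact
geometry: `2 dη(X, Y) = X η(Y) - Y η(X) - η([X, Y])`. -/
def extDeriv (η : Π x : M, TangentSpace 𝓘(ℝ, E) x →L[ℝ] ℝ)
    (X Y : Π x : M, TangentSpace 𝓘(ℝ, E) x) (p : M) : ℝ :=
  (1 / 2 : ℝ) *
    (mvfderiv 𝓘(ℝ, E) (fun x ↦ η x (Y x)) p (X p)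
      - mvfderiv 𝓘(ℝ, E) (fun x ↦ η x (X x)) p (Y p)
      - η p (mlieBracket 𝓘(ℝ, E) X Y p))

/-- The Nijenhuis tensor
`[φ, φ](X, Y) = φ²[X, Y] + [φX, φY] - φ[φX, Y] - φ[X, φY]`. -/
def nijenhuis (φ : Π x : M, TangentSpace 𝓘(ℝ, E) x →L[ℝ] TangentSpace 𝓘(ℝ, E) x)
    (X Y : Π x : M, TangentSpace 𝓘(ℝ, E) x) (p : M) : TangentSpace 𝓘(ℝ, E) p :=
  φ p (φ p (mlieBracket 𝓘(ℝ, E) X Y p))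
    + mlieBracket 𝓘(ℝ, E) (fun x ↦ φ x (X x)) (fun x ↦ φ x (Y x)) p
    - φ p (mlieBracket 𝓘(ℝ, E) (fun x ↦ φ x (X x)) Y p)
    - φ p (mlieBracket 𝓘(ℝ, E) X (fun x ↦ φ x (Y x)) p)

variable [RiemannianBundle (fun x : M ↦ TangentSpace 𝓘(ℝ, E) x)]

/-- `(φ, ξ, η, g)` is an almost contact metric structure on `M`, where `g` is the metric of `M`. -/
structure IsAlmostContactMetric
    (φ : Π x : M, TangentSpace 𝓘(ℝ, E) x →L[ℝ] TangentSpace 𝓘(ℝ, E) x)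
    (ξ : Π x : M, TangentSpace 𝓘(ℝ, E) x)
    (η : Π x : M, TangentSpace 𝓘(ℝ, E) x →L[ℝ] ℝ) : Prop where
  smooth_φ : ContMDiff 𝓘(ℝ, E) (𝓘(ℝ, E).prod 𝓘(ℝ, E →L[ℝ] E)) ∞
    (fun x ↦ (⟨x, φ x⟩ : TotalSpace (E →L[ℝ] E)
      (fun x : M ↦ TangentSpace 𝓘(ℝ, E) x →L[ℝ] TangentSpace 𝓘(ℝ, E) x)))
  smooth_ξ : ContMDiff 𝓘(ℝ, E) (𝓘(ℝ, E).prod 𝓘(ℝ, E)) ∞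
    (fun x ↦ (⟨x, ξ x⟩ : TangentBundle 𝓘(ℝ, E) M))
  smooth_η : ContMDiff 𝓘(ℝ, E) (𝓘(ℝ, E).prod 𝓘(ℝ, E →L[ℝ] ℝ)) ∞
    (fun x ↦ (⟨x, η x⟩ : TotalSpace (E →L[ℝ] ℝ)
      (fun x : M ↦ TangentSpace 𝓘(ℝ, E) x →L[ℝ] Bundle.Trivial M ℝ x)))
  φ_ξ : ∀ p, φ p (ξ p) = 0
  η_ξ : ∀ p, η p (ξ p) = 1
  φ_φ : ∀ p (v : TangentSpace 𝓘(ℝ, E) p), φ p (φ p v) = -v + η p v • ξ p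
  inner_φ_φ : ∀ p (v w : TangentSpace 𝓘(ℝ, E) p),
    inner ℝ (φ p v) (φ p w) = inner ℝ v w - η p v * η p w

/-- A Sasakian structure is a normal contact metric structure. Both conditions are tensorial, so
they may be tested on vector fields that are differentiable at the point. -/
structure IsSasakian
    (φ : Π x : M, TangentSpace 𝓘(ℝ, E) x →L[ℝ] TangentSpace 𝓘(ℝ, E) x)
    (ξ : Π x : M, TangentSpace 𝓘(ℝ, E) x)
    (η : Π x : M, TangentSpace 𝓘(ℝ, E) x →L[ℝ] ℝ) : Prop
    extends IsAlmostContactMetric φ ξ η where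
  contact : ∀ (p : M) (X Y : Π x : M, TangentSpace 𝓘(ℝ, E) x),
    MDiffAt (T% X) p → MDiffAt (T% Y) p →
      inner ℝ (X p) (φ p (Y p)) = extDeriv η X Y p
  normal : ∀ (p : M) (X Y : Π x : M, TangentSpace 𝓘(ℝ, E) x),
    MDiffAt (T% X) p → MDiffAt (T% Y) p →
      nijenhuis φ X Y p + (2 * extDeriv η X Y p) • ξ p = 0

end Contact

section Submersions

variable {E : Type*} [NormedAddCommGroup E] [NormedSpace ℝ E] [FiniteDimensional ℝ E]
  {M : Type*} [TopologicalSpace M] [ChartedSpace E M] [IsManifold 𝓘(ℝ, E) ∞ M]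
  [RiemannianBundle (fun x : M ↦ TangentSpace 𝓘(ℝ, E) x)]
  {E' : Type*} [NormedAddCommGroup E'] [NormedSpace ℝ E']
  {N : Type*} [TopologicalSpace N] [ChartedSpace E' N]

variable (E E') in
/-- The vertical space `ker proj_*` at `p`. -/
def verticalSpace (proj : M → N) (p : M) : Submodule ℝ (TangentSpace 𝓘(ℝ, E) p) :=
  LinearMap.ker (mfderiv 𝓘(ℝ, E) 𝓘(ℝ, E') proj p).toLinearMap

variable (E E') in
/-- The horizontal space `(ker proj_*)^⊥` at `p`. -/
def horizontalSpace (proj : M → N) (p : M) : Submodule ℝ (TangentSpace 𝓘(ℝ, E) p) :=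
  (verticalSpace E E' proj p)ᗮ

variable (E E') in
/-- The orthogonal projection `𝒱` onto the vertical space. -/
def vert (proj : M → N) (p : M) : TangentSpace 𝓘(ℝ, E) p →L[ℝ] TangentSpace 𝓘(ℝ, E) p :=
  (verticalSpace E E' proj p).starProjection

variable (E E') in
/-- The orthogonal projection `ℋ` onto the horizontal space. -/
def hor (proj : M → N) (p : M) : TangentSpace 𝓘(ℝ, E) p →L[ℝ] TangentSpace 𝓘(ℝ, E) p :=
  (horizontalSpace E E' proj p).starProjection

variable (E E') in
/-- `proj` is a Riemannian submersion between the Riemannian manifolds `M` and `N`. -/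
structure IsRiemannianSubmersion
    [RiemannianBundle (fun x : N ↦ TangentSpace 𝓘(ℝ, E') x)] (proj : M → N) : Prop where
  finrank_lt : Module.finrank ℝ E' < Module.finrank ℝ E
  contMDiff : ContMDiff 𝓘(ℝ, E) 𝓘(ℝ, E') ∞ proj
  surjective : Function.Surjective proj
  mfderiv_surjective : ∀ p, Function.Surjective (mfderiv 𝓘(ℝ, E) 𝓘(ℝ, E') proj p)
  inner_mfderiv : ∀ p, ∀ y ∈ horizontalSpace E E' proj p, ∀ z ∈ horizontalSpace E E' proj p,
    inner ℝ y z
      = inner ℝ (mfderiv 𝓘(ℝ, E) 𝓘(ℝ, E') proj p y) (mfderiv 𝓘(ℝ, E) 𝓘(ℝ, E') proj p z)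

variable (E E') in
/-- `proj` is an anti-invariant Riemannian submersion: `φ (ker proj_*) ⊆ (ker proj_*)^⊥`. -/
structure IsAntiInvariantSubmersion
    [RiemannianBundle (fun x : N ↦ TangentSpace 𝓘(ℝ, E') x)]
    (φ : Π x : M, TangentSpace 𝓘(ℝ, E) x →L[ℝ] TangentSpace 𝓘(ℝ, E) x) (proj : M → N) : Prop
    extends IsRiemannianSubmersion E E' proj where
  anti_invariant : ∀ p, ∀ v ∈ verticalSpace E E' proj p, φ p v ∈ horizontalSpace E E' proj p

variable [IsContMDiffRiemannianBundle 𝓘(ℝ, E) ∞ E (fun x : M ↦ TangentSpace 𝓘(ℝ, E) x)]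

variable (E E') in
/-- O'Neill's tensor `𝒯_u v = 𝒱 ∇_{𝒱u} ℋF + ℋ ∇_{𝒱u} 𝒱F`, where `F` is a local vector field with
value `v` at `p`. -/
def oneillT (proj : M → N) (p : M) (u v : TangentSpace 𝓘(ℝ, E) p) : TangentSpace 𝓘(ℝ, E) p :=
  vert E E' proj p
      (leviCivita E M (fun x ↦ hor E E' proj x (extend E v x)) p (vert E E' proj p u))
    + hor E E' proj p
      (leviCivita E M (fun x ↦ vert E E' proj x (extend E v x)) p (vert E E' proj p u))

variable (E E') in
/-- O'Neill's tensor `𝒜_u v = 𝒱 ∇_{ℋu} ℋF + ℋ ∇_{ℋu} 𝒱F`, where `F` is a local vector field with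
value `v` at `p`. -/
def oneillA (proj : M → N) (p : M) (u v : TangentSpace 𝓘(ℝ, E) p) : TangentSpace 𝓘(ℝ, E) p :=
  vert E E' proj p
      (leviCivita E M (fun x ↦ hor E E' proj x (extend E v x)) p (hor E E' proj p u))
    + hor E E' proj p
      (leviCivita E M (fun x ↦ vert E E' proj x (extend E v x)) p (hor E E' proj p u))

variable (E E') in
/-- The angle between a tangent vector at `p` and the horizontal space at `p`, that is, the angle
between the vector and its horizontal projection. (It is `pi / 2` for vertical vectors, and
by convention for the zero vector.) -/
def horizontalAngle (proj : M → N) (p : M) (v : TangentSpace 𝓘(ℝ, E) p) : ℝ :=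
  InnerProductGeometry.angle v (hor E E' proj p v)

variable (E E') in
/-- `proj` is a Clairaut submersion with the positive function `r`: along every geodesic `α` of `M`,
`(r ∘ α) sin θ` is constant, `θ` being the angle between `α̇` and the horizontal space. -/
structure IsClairautWith [RiemannianBundle (fun x : N ↦ TangentSpace 𝓘(ℝ, E') x)]
    (proj : M → N) (r : M → ℝ) : Prop
    extends IsRiemannianSubmersion E E' proj where
  pos : ∀ p, 0 < r p
  constant : ∀ (α : ℝ → M) (J : Set ℝ), IsGeodesicOn E α J →
    ∃ c : ℝ, ∀ t ∈ J, r (α t) * Real.sin (horizontalAngle E E' proj (α t) (velocity E α t)) = c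

end Submersions

end ClairautSubmersion

end

/-!
Along a geodesic `α` the speed is constant and `sin² θ = ‖𝒱 α̇‖² / ‖α̇‖²`, so `e^f sin θ` is constant
if and only if `e^{2f} ‖𝒱 α̇‖²` is (a constant geodesic has `sin θ = 1` by convention, and then `f ∘ α`
is constant as well). As the derivative of `‖𝒱 α̇‖² = g(𝒱 α̇, α̇)` is `g((∇_α̇ 𝒱) α̇, α̇)`, Clairaut's
relation is the equation `df(α̇) ‖𝒱 α̇‖² = -½ g((∇_α̇ 𝒱) α̇, α̇)` (`clairaut_along_iff`).

On a Sasakian manifold `∇_u ξ = -φ u` and `(∇_u φ) v = g(u, v) ξ - η(v) u`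
(`IsSasakian.leviCivita_ξ`, `IsSasakian.covEndo_φ`). Expanding `∇_α̇ (ℋ φ ℋ α̇)` by the product rule,
one finds that the right-hand side of the second condition is also `-½ g((∇_α̇ 𝒱) α̇, α̇)`
(`clairaut_rhs_eq`). Its left-hand side is `df(ℋ α̇) ‖𝒱 α̇‖²`. Every tangent vector is the velocity of
a geodesic (`exists_geodesic`), so both conditions are equations for all tangent vectors `u`, and they
differ only in that one has `df(u)` and the other `df(ℋ u)`. What remains is to derive `df(v) = 0`
for vertical `v` from either of them.

From Clairaut's relation this follows by taking `u = v`, as `g((∇_v 𝒱) v, v) = 0`.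
From the second condition it is the rigidity theorem `mvfderiv_vertical_of_clairaut`. Separating
the equation by its degree in the horizontal part of `u`, one gets for vertical `v` and horizontal
`x` that `g((∇_v 𝒱) v, x) = -df(x) ‖v‖²` (the fibres are totally umbilical) and
`g((∇_x 𝒱) v, x) = 0`. The first, with `x = ξ`, gives `df(ξ) = 0`. The second, polarised, gives
`(∇_ξ 𝒱) v = φ v`, and this makes the Jacobi identity of `V`, `φ V` and `ξ` for a vertical field `V`
say that `g((∇_V 𝒱) V, φ V) = 0`, that is, `df(φ V) = 0`. Finally `[ξ, φ V]` is `-2 V` up to the image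
under `φ` of a vertical field, and since `df` annihilates `ξ`, `φ V` and that image, `df(V) = 0`.

Tensor fields are handled as follows: a field of endomorphisms is smooth if it preserves smooth
vector fields (`IsSmoothEndo`), its covariant derivative is `covEndo`, and fields along curves are
written as combinations of smooth vector fields on `M` with coefficients depending on the parameter
(`covDerivAlong_sum`).
-/

set_option linter.unusedSectionVars false

noncomputable section

namespace ClairautSubmersion

/-! ### Smooth vector fields and frames -/

section SmoothFields

open Filter Topology

variable {E : Type*} [NormedAddCommGroup E] [NormedSpace ℝ E]
  {M : Type*} [TopologicalSpace M] [ChartedSpace E M] [IsManifold 𝓘(ℝ, E) ∞ M]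

/-- A globally defined vector field of class `C^∞`. -/
abbrev IsSmoothField (X : Π x : M, TangentSpace 𝓘(ℝ, E) x) : Prop := CMDiff ∞ (T% X)

theorem IsSmoothField.mdiffAt {X : Π x : M, TangentSpace 𝓘(ℝ, E) x} (hX : IsSmoothField X) (p : M) :
    MDiffAt (T% X) p :=
  (hX p).mdifferentiableAt (by simp)

theorem IsSmoothField.mlieBracket [CompleteSpace E] {X Y : Π x : M, TangentSpace 𝓘(ℝ, E) x}
    (hX : IsSmoothField X) (hY : IsSmoothField Y) : IsSmoothField (mlieBracket 𝓘(ℝ, E) X Y) := by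
  intro p
  have : IsManifold 𝓘(ℝ, E) ((((⊤ : ℕ∞) : ℕ∞ω)) + 1) M := by
    simpa using (inferInstance : IsManifold 𝓘(ℝ, E) ∞ M)
  have : IsManifold 𝓘(ℝ, E) (minSmoothness ℝ 2) M := by
    rw [minSmoothness_of_isRCLikeNormedField]; infer_instance
  exact ContMDiffAt.mlieBracket_vectorField (n := ⊤) (m := ⊤) (hX p) (hY p) (by simp)

theorem contMDiff_mvfderiv_apply {h : M → ℝ} (hh : ContMDiff 𝓘(ℝ, E) 𝓘(ℝ, ℝ) ∞ h)
    {X : Π x : M, TangentSpace 𝓘(ℝ, E) x} (hX : IsSmoothField X) :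
    ContMDiff 𝓘(ℝ, E) 𝓘(ℝ, ℝ) ∞ (fun x ↦ mvfderiv 𝓘(ℝ, E) h x (X x)) := by
  have h1 := (hh.contMDiff_tangentMap (m := ∞) (by simp)).comp hX
  intro p
  have h2 := h1 p
  rw [contMDiffAt_totalSpace] at h2
  convert h2.2 using 2 with x
  simp [tangentMap]
  rfl

theorem IsSmoothField.add {X Y : Π x : M, TangentSpace 𝓘(ℝ, E) x}
    (hX : IsSmoothField X) (hY : IsSmoothField Y) : IsSmoothField (fun x ↦ X x + Y x) :=
  ContMDiff.add_section hX hY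

theorem IsSmoothField.sub {X Y : Π x : M, TangentSpace 𝓘(ℝ, E) x}
    (hX : IsSmoothField X) (hY : IsSmoothField Y) : IsSmoothField (fun x ↦ X x - Y x) :=
  ContMDiff.sub_section hX hY

theorem IsSmoothField.neg {X : Π x : M, TangentSpace 𝓘(ℝ, E) x}
    (hX : IsSmoothField X) : IsSmoothField (fun x ↦ - X x) :=
  ContMDiff.neg_section hX

theorem IsSmoothField.smul {h : M → ℝ} (hh : ContMDiff 𝓘(ℝ, E) 𝓘(ℝ, ℝ) ∞ h)
    {X : Π x : M, TangentSpace 𝓘(ℝ, E) x} (hX : IsSmoothField X) :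
    IsSmoothField (fun x ↦ h x • X x) :=
  ContMDiff.smul_section hh hX

theorem IsSmoothField.const_smul (c : ℝ)
    {X : Π x : M, TangentSpace 𝓘(ℝ, E) x} (hX : IsSmoothField X) :
    IsSmoothField (fun x ↦ c • X x) :=
  hX.smul (h := fun _ ↦ c) contMDiff_const

theorem isSmoothField_sum {ι : Type*} [Fintype ι] {X : ι → Π x : M, TangentSpace 𝓘(ℝ, E) x}
    (hX : ∀ i, IsSmoothField (X i)) : IsSmoothField (fun x ↦ ∑ i, X i x) :=
  ContMDiff.sum_section fun i _ ↦ hX i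

variable [FiniteDimensional ℝ E] [T2Space M]

/-- A local frame whose members are globally defined smooth vector fields: near `p` they have
constant coordinates in the trivialization of the tangent bundle by the chart at `p`. -/
theorem exists_smooth_frame (p : M) :
    ∃ F : Fin (Module.finrank ℝ E) → Π x : M, TangentSpace 𝓘(ℝ, E) x,
      (∀ i, IsSmoothField (F i)) ∧
      ∀ᶠ x in 𝓝 p, ∀ i, F i x =
        (trivializationAt E (TangentSpace 𝓘(ℝ, E) : M → Type _) p).symm x
          (Module.finBasis ℝ E i) := by
  set e := trivializationAt E (TangentSpace 𝓘(ℝ, E) : M → Type _) p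
  obtain ⟨ψ⟩ : Nonempty (SmoothBumpFunction 𝓘(ℝ, E) p) := inferInstance
  have hb : tsupport ψ ⊆ e.baseSet := by
    intro x hx
    have := ψ.tsupport_subset_chartAt_source hx
    simpa [e] using this
  refine ⟨fun i ↦ (ψ : M → ℝ) • e.localFrame (Module.finBasis ℝ E) i, fun i ↦ ?_, ?_⟩
  · exact ContMDiffOn.smul_section_of_tsupport (ψ.contMDiff.contMDiffOn) e.open_baseSet hb
      (e.contMDiffOn_localFrame_baseSet ∞ (Module.finBasis ℝ E) i)
  · have h2 : ∀ᶠ x in 𝓝 p, x ∈ e.baseSet := e.open_baseSet.mem_nhds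
      (FiberBundle.mem_baseSet_trivializationAt' p)
    filter_upwards [ψ.eventuallyEq_one, h2] with x hx hx2 i
    rw [Pi.smul_apply', hx, e.localFrame_apply_of_mem_baseSet _ hx2]
    simp [Bundle.Trivialization.basisAt]

/-- Near `p`, every tangent vector is the combination of the frame vectors whose coefficients are
its coordinates in the trivialization by the chart at `p`. -/
theorem eventually_eq_sum_frame {p : M}
    {F : Fin (Module.finrank ℝ E) → Π x : M, TangentSpace 𝓘(ℝ, E) x}
    (hF : ∀ᶠ x in 𝓝 p, ∀ i, F i x =
        (trivializationAt E (TangentSpace 𝓘(ℝ, E) : M → Type _) p).symm x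
          (Module.finBasis ℝ E i)) :
    ∀ᶠ x in 𝓝 p, ∀ u : TangentSpace 𝓘(ℝ, E) x,
      u = ∑ i, (Module.finBasis ℝ E).repr
        ((trivializationAt E (TangentSpace 𝓘(ℝ, E) : M → Type _) p) ⟨x, u⟩).2 i • F i x := by
  set e := trivializationAt E (TangentSpace 𝓘(ℝ, E) : M → Type _) p
  have h2 : ∀ᶠ x in 𝓝 p, x ∈ e.baseSet := e.open_baseSet.mem_nhds
      (FiberBundle.mem_baseSet_trivializationAt' p)
  filter_upwards [hF, h2] with x hx hx2 u
  simp_rw [hx]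
  have h3 : ∀ w : E, e.symm x w = e.symmL ℝ x w := fun w ↦ (e.symmL_apply (hb := hx2) ..).symm
  simp_rw [h3, ← map_smul, ← map_sum, Module.Basis.sum_repr]
  rw [← h3, e.symm_apply_apply_mk hx2]

theorem exists_smooth_extension {p : M} (v : TangentSpace 𝓘(ℝ, E) p) :
    ∃ X : Π x : M, TangentSpace 𝓘(ℝ, E) x, IsSmoothField X ∧ X p = v := by
  obtain ⟨F, hF, hF'⟩ := exists_smooth_frame (E := E) p
  have h := (eventually_eq_sum_frame hF').self_of_nhds v
  exact ⟨fun x ↦ ∑ i, (Module.finBasis ℝ E).repr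
        ((trivializationAt E (TangentSpace 𝓘(ℝ, E) : M → Type _) p) ⟨p, v⟩).2 i • F i x,
    isSmoothField_sum fun i ↦ (hF i).const_smul _, h.symm⟩

/-- The coordinates of a differentiable vector field are differentiable. -/
theorem mdiffAt_repr {p : M} {Z : Π x : M, TangentSpace 𝓘(ℝ, E) x} (hZ : MDiffAt (T% Z) p)
    (i : Fin (Module.finrank ℝ E)) :
    MDiffAt (fun x ↦ (Module.finBasis ℝ E).repr
        ((trivializationAt E (TangentSpace 𝓘(ℝ, E) : M → Type _) p) ⟨x, Z x⟩).2 i) p := by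
  rw [mdifferentiableAt_totalSpace] at hZ
  have h := ((LinearMap.toContinuousLinearMap
    ((Module.finBasis ℝ E).coord i)).differentiableAt.mdifferentiableAt).comp p hZ.2
  exact h

/-- A field of endomorphisms of the tangent spaces is smooth if it maps smooth vector fields to
smooth vector fields. -/
def IsSmoothEndo (L : Π x : M, TangentSpace 𝓘(ℝ, E) x →L[ℝ] TangentSpace 𝓘(ℝ, E) x) : Prop :=
  ∀ X : Π x : M, TangentSpace 𝓘(ℝ, E) x, IsSmoothField X → IsSmoothField (fun x ↦ L x (X x))

theorem IsSmoothEndo.comp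
    {L L' : Π x : M, TangentSpace 𝓘(ℝ, E) x →L[ℝ] TangentSpace 𝓘(ℝ, E) x}
    (hL : IsSmoothEndo L) (hL' : IsSmoothEndo L') : IsSmoothEndo (fun x ↦ L x ∘L L' x) :=
  fun X hX ↦ hL _ (hL' X hX)

/-- Smooth fields of endomorphisms also preserve differentiability of vector fields at a point: expand
the vector field in a frame. -/
theorem IsSmoothEndo.mdiffAt
    {L : Π x : M, TangentSpace 𝓘(ℝ, E) x →L[ℝ] TangentSpace 𝓘(ℝ, E) x}
    (hL : IsSmoothEndo L) {p : M} {Z : Π x : M, TangentSpace 𝓘(ℝ, E) x} (hZ : MDiffAt (T% Z) p) :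
    MDiffAt (T% (fun x ↦ L x (Z x))) p := by
  obtain ⟨F, hF, hF'⟩ := exists_smooth_frame (E := E) p
  have h := eventually_eq_sum_frame hF'
  have h1 : MDiffAt (T% (fun x ↦ ∑ i, (Module.finBasis ℝ E).repr
        ((trivializationAt E (TangentSpace 𝓘(ℝ, E) : M → Type _) p) ⟨x, Z x⟩).2 i •
        L x (F i x))) p :=
    MDifferentiableAt.sum_section fun i _ ↦
      (mdiffAt_repr hZ i).smul_section ((hL _ (hF i)).mdiffAt p)
  refine h1.congr_of_eventuallyEq ?_
  filter_upwards [h] with x hx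
  conv_lhs => rw [hx (Z x)]
  simp

variable [RiemannianBundle (fun x : M ↦ TangentSpace 𝓘(ℝ, E) x)]
  [IsContMDiffRiemannianBundle 𝓘(ℝ, E) ∞ E (fun x : M ↦ TangentSpace 𝓘(ℝ, E) x)]

theorem IsSmoothField.inner {X Y : Π x : M, TangentSpace 𝓘(ℝ, E) x}
    (hX : IsSmoothField X) (hY : IsSmoothField Y) :
    ContMDiff 𝓘(ℝ, E) 𝓘(ℝ, ℝ) ∞ (fun x ↦ inner ℝ (X x) (Y x)) :=
  ContMDiff.inner_bundle (E := fun x : M ↦ TangentSpace 𝓘(ℝ, E) x) hX hY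

/-- A vector field is smooth as soon as its inner products with all smooth vector fields are: its
coefficients in a frame are obtained from such inner products by inverting the Gram matrix. -/
theorem isSmoothField_of_inner {Z : Π x : M, TangentSpace 𝓘(ℝ, E) x}
    (hZ : ∀ W : Π x : M, TangentSpace 𝓘(ℝ, E) x, IsSmoothField W →
      ContMDiff 𝓘(ℝ, E) 𝓘(ℝ, ℝ) ∞ (fun x ↦ inner ℝ (Z x) (W x))) : IsSmoothField Z := by
  intro p
  obtain ⟨F, hF, hF'⟩ := exists_smooth_frame (E := E) p
  set e := trivializationAt E (TangentSpace 𝓘(ℝ, E) : M → Type _) p with he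
  set b := Module.finBasis ℝ E with hb
  let G : M → Matrix (Fin (Module.finrank ℝ E)) (Fin (Module.finrank ℝ E)) ℝ :=
    fun x ↦ Matrix.gram ℝ (fun i ↦ F i x)
  have hdet : ∀ A : M → Matrix (Fin (Module.finrank ℝ E)) (Fin (Module.finrank ℝ E)) ℝ,
      (∀ i j, ContMDiff 𝓘(ℝ, E) 𝓘(ℝ, ℝ) ∞ (fun x ↦ A x i j)) →
      ContMDiff 𝓘(ℝ, E) 𝓘(ℝ, ℝ) ∞ (fun x ↦ (A x).det) := by
    intro A hA
    simp_rw [Matrix.det_apply']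
    refine ContMDiff.sum fun σ _ ↦ contMDiff_const.mul (ContMDiff.prod fun i _ ↦ hA _ _)
  have hG : ∀ i j, ContMDiff 𝓘(ℝ, E) 𝓘(ℝ, ℝ) ∞ (fun x ↦ G x i j) :=
    fun i j ↦ (hF i).inner (hF j)
  have hadj : ∀ i j, ContMDiff 𝓘(ℝ, E) 𝓘(ℝ, ℝ) ∞ (fun x ↦ (G x).adjugate i j) := by
    intro i j
    simp_rw [Matrix.adjugate_apply]
    refine hdet _ fun k l ↦ ?_
    by_cases hk : k = j
    · subst hk; simpa using contMDiff_const
    · simpa [Matrix.updateRow_apply, hk] using hG k l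
  have hp : (G p).det ≠ 0 := by
    rw [Matrix.det_gram_ne_zero_iff_linearIndependent]
    have h1 := hF'.self_of_nhds
    have h2 := (e.basisAt b (FiberBundle.mem_baseSet_trivializationAt' p)).linearIndependent
    convert! h2 using 1
    ext1 i
    rw [h1]
    simp [Bundle.Trivialization.basisAt]
  have hev : ∀ᶠ x in 𝓝 p, (G x).det ≠ 0 :=
    (hdet G hG).continuous.continuousAt.eventually_ne hp
  have h1 : CMDiffAt ∞ (T% (fun x ↦ ∑ i, ((G x).det⁻¹ *
      ∑ j, (G x).adjugate i j * inner ℝ (Z x) (F j x)) • F i x)) p := by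
    refine ContMDiffAt.sum_section fun i _ ↦ ContMDiffAt.smul_section ?_ (hF i p)
    refine ((hdet G hG p).inv₀ hp).mul (ContMDiffAt.sum fun j _ ↦ ?_)
    exact (hadj i j p).mul (hZ _ (hF j) p)
  refine h1.congr_of_eventuallyEq ?_
  filter_upwards [hev, eventually_eq_sum_frame hF'] with x hx hx2
  congr 1
  conv_lhs => rw [hx2 (Z x)]
  refine Finset.sum_congr rfl fun i _ ↦ ?_
  congr 1
  set c : Fin (Module.finrank ℝ E) → ℝ := fun i ↦ b.repr (e ⟨x, Z x⟩).2 i with hc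
  have h3 : (fun j ↦ inner ℝ (Z x) (F j x)) = (G x).mulVec c := by
    ext j
    conv_lhs => rw [hx2 (Z x)]
    rw [sum_inner]
    simp only [Matrix.mulVec, dotProduct, G, Matrix.gram_apply, real_inner_smul_left]
    exact Finset.sum_congr rfl fun k _ ↦ by rw [mul_comm, real_inner_comm]
  have h4 : (∑ j, (G x).adjugate i j * inner ℝ (Z x) (F j x)) = (G x).det * c i := by
    change ((G x).adjugate.mulVec (fun j ↦ inner ℝ (Z x) (F j x))) i = _
    rw [h3, Matrix.mulVec_mulVec, Matrix.adjugate_mul, Matrix.smul_mulVec]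
    simp
  rw [h4, ← mul_assoc, inv_mul_cancel₀ hx, one_mul]

/-- The covariant derivative of a smooth field along a smooth field is smooth, because the Koszul
formula is. -/
theorem IsSmoothField.leviCivita {X Y : Π x : M, TangentSpace 𝓘(ℝ, E) x}
    (hX : IsSmoothField X) (hY : IsSmoothField Y) :
    IsSmoothField (fun x ↦ leviCivita E M Y x (X x)) := by
  refine isSmoothField_of_inner fun W hW ↦ ?_
  have h : (fun x ↦ Inner.inner ℝ (ClairautSubmersion.leviCivita E M Y x (X x)) (W x))
      = fun x ↦ koszul Y X W x := by
    ext x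
    exact inner_leviCivitaFun (hY.mdiffAt x) (hX.mdiffAt x) (hW.mdiffAt x)
  rw [h]
  unfold koszul
  refine contMDiff_const.mul ?_
  exact (((((contMDiff_mvfderiv_apply (hY.inner hW) hX).add
    (contMDiff_mvfderiv_apply (hX.inner hW) hY)).sub
    (contMDiff_mvfderiv_apply (hX.inner hY) hW)).add ((hX.mlieBracket hY).inner hW)).sub
    ((hX.mlieBracket hW).inner hY)).sub ((hY.mlieBracket hW).inner hX)

end SmoothFields

/-! ### The Levi-Civita connection and derivatives of endomorphism fields -/

section CovariantCalculus

open Filter Topology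

variable {E : Type*} [NormedAddCommGroup E] [NormedSpace ℝ E] [FiniteDimensional ℝ E]
  {M : Type*} [TopologicalSpace M] [ChartedSpace E M] [IsManifold 𝓘(ℝ, E) ∞ M]

/-- Second derivatives commute up to the Lie bracket: `[X, Y] h = X (Y h) - Y (X h)`. This follows
from the Jacobi identity for `X`, `Y`, `h Z` and the product rule for the bracket. -/
theorem mvfderiv_mlieBracket {h : M → ℝ} (hh : ContMDiff 𝓘(ℝ, E) 𝓘(ℝ, ℝ) ∞ h)
    {X Y : Π x : M, TangentSpace 𝓘(ℝ, E) x} (hX : IsSmoothField X) (hY : IsSmoothField Y) (p : M) :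
    mvfderiv 𝓘(ℝ, E) h p (mlieBracket 𝓘(ℝ, E) X Y p)
      = mvfderiv 𝓘(ℝ, E) (fun x ↦ mvfderiv 𝓘(ℝ, E) h x (Y x)) p (X p)
        - mvfderiv 𝓘(ℝ, E) (fun x ↦ mvfderiv 𝓘(ℝ, E) h x (X x)) p (Y p) := by
  have : IsManifold 𝓘(ℝ, E) (minSmoothness ℝ 3) M := by
    rw [minSmoothness_of_isRCLikeNormedField]; infer_instance
  -- the argument needs a nonzero tangent vector, so the zero-dimensional case is separate
  rcases subsingleton_or_nontrivial E with hE | hE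
  · have h0 : ∀ v : TangentSpace 𝓘(ℝ, E) p, v = 0 := fun v ↦ Subsingleton.elim (α := E) v 0
    simp [h0 (mlieBracket 𝓘(ℝ, E) X Y p), h0 (X p), h0 (Y p)]
  obtain ⟨v, hv⟩ : ∃ v : TangentSpace 𝓘(ℝ, E) p, v ≠ 0 := exists_ne (0 : E)
  let Z : Π x : M, TangentSpace 𝓘(ℝ, E) x := extend E v
  have hZp : Z p = v := extend_apply_self ..
  obtain ⟨s, hs, hZs⟩ := exists_contMDiffOn_extend (k := ∞) 𝓘(ℝ, E) E v
  have hZ : CMDiffAt ∞ (T% Z) p := hZs.contMDiffAt hs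
  have hZev : ∀ᶠ x in 𝓝 p, MDiffAt (T% Z) x := by
    filter_upwards [eventually_mem_nhds_iff.mpr hs] with x hx
    exact (hZs.contMDiffAt hx).mdifferentiableAt (by simp)
  have h1 (W : Π x : M, TangentSpace 𝓘(ℝ, E) x) :
      mlieBracket 𝓘(ℝ, E) W (h • Z) =ᶠ[𝓝 p]
        (fun x ↦ mvfderiv 𝓘(ℝ, E) h x (W x)) • Z + h • mlieBracket 𝓘(ℝ, E) W Z := by
    filter_upwards [hZev] with x hx
    exact mlieBracket_smul_right ((hh x).mdifferentiableAt (by simp)) hx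
  have hmin : (minSmoothness ℝ 2 : ℕ∞ω) ≤ ∞ := by
    rw [minSmoothness_of_isRCLikeNormedField]; exact ENat.LEInfty.out
  have jac := leibniz_identity_mlieBracket_apply ((hX p).of_le hmin) ((hY p).of_le hmin)
    ((ContMDiffAt.smul_section (hh p) hZ).of_le hmin : CMDiffAt _ (T% (h • Z)) p)
  have jac' := leibniz_identity_mlieBracket_apply ((hX p).of_le hmin) ((hY p).of_le hmin)
    (hZ.of_le hmin)
  rw [(EventuallyEq.rfl (f := X)).mlieBracket_vectorField_eq (h1 Y),
    (EventuallyEq.rfl (f := Y)).mlieBracket_vectorField_eq (h1 X)] at jac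
  have hhd : MDiffAt h p := (hh p).mdifferentiableAt (by simp)
  have hZd : MDiffAt (T% Z) p := hZev.self_of_nhds
  have : IsManifold 𝓘(ℝ, E) ((((⊤ : ℕ∞) : ℕ∞ω)) + 1) M := by
    simpa using (inferInstance : IsManifold 𝓘(ℝ, E) ∞ M)
  have : IsManifold 𝓘(ℝ, E) (minSmoothness ℝ 2) M := by
    rw [minSmoothness_of_isRCLikeNormedField]; infer_instance
  have hb {W : Π x : M, TangentSpace 𝓘(ℝ, E) x} (hW : IsSmoothField W) :
      MDiffAt (T% (mlieBracket 𝓘(ℝ, E) W Z)) p :=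
    (ContMDiffAt.mlieBracket_vectorField (n := ⊤) (m := ⊤) (hW p) hZ (by simp)).mdifferentiableAt
      (by simp)
  have hd {W : Π x : M, TangentSpace 𝓘(ℝ, E) x} (hW : IsSmoothField W) :
      MDiffAt (fun x ↦ mvfderiv 𝓘(ℝ, E) h x (W x)) p :=
    (contMDiff_mvfderiv_apply hh hW p).mdifferentiableAt (by simp)
  rw [mlieBracket_add_right ((hd hY).smul_section hZd) (hhd.smul_section (hb hY)),
    mlieBracket_add_right ((hd hX).smul_section hZd) (hhd.smul_section (hb hX)),
    mlieBracket_smul_right (hd hY) hZd, mlieBracket_smul_right (hd hX) hZd,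
    mlieBracket_smul_right hhd (hb hY), mlieBracket_smul_right hhd (hb hX),
    mlieBracket_smul_right hhd hZd, jac'] at jac
  -- the Jacobi identities for `h Z` and for `Z` differ by a multiple of `Z`
  have key : (mvfderiv 𝓘(ℝ, E) h p (mlieBracket 𝓘(ℝ, E) X Y p)
      - (mvfderiv 𝓘(ℝ, E) (fun x ↦ mvfderiv 𝓘(ℝ, E) h x (Y x)) p (X p)
        - mvfderiv 𝓘(ℝ, E) (fun x ↦ mvfderiv 𝓘(ℝ, E) h x (X x)) p (Y p))) • Z p = 0 := by
    rw [← sub_eq_zero] at jac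
    rw [← neg_eq_zero, ← jac]
    module
  rw [hZp] at key
  exact sub_eq_zero.mp ((smul_eq_zero.mp key).resolve_right hv)

variable [RiemannianBundle (fun x : M ↦ TangentSpace 𝓘(ℝ, E) x)]
  [IsContMDiffRiemannianBundle 𝓘(ℝ, E) ∞ E (fun x : M ↦ TangentSpace 𝓘(ℝ, E) x)]

theorem leviCivita_add {Y Z : Π x : M, TangentSpace 𝓘(ℝ, E) x} {p : M}
    (hY : MDiffAt (T% Y) p) (hZ : MDiffAt (T% Z) p) (u : TangentSpace 𝓘(ℝ, E) p) :
    leviCivita E M (fun x ↦ Y x + Z x) p u = leviCivita E M Y p u + leviCivita E M Z p u :=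
  congr($((leviCivita E M).isCovariantDerivativeOnUniv.add hY hZ) u)

theorem leviCivita_smul {h : M → ℝ} {Y : Π x : M, TangentSpace 𝓘(ℝ, E) x} {p : M}
    (hh : MDiffAt h p) (hY : MDiffAt (T% Y) p) (u : TangentSpace 𝓘(ℝ, E) p) :
    leviCivita E M (fun x ↦ h x • Y x) p u
      = h p • leviCivita E M Y p u + mvfderiv 𝓘(ℝ, E) h p u • Y p :=
  congr($((leviCivita E M).isCovariantDerivativeOnUniv.leibniz hY hh) u)

theorem leviCivita_const_smul (c : ℝ) {Y : Π x : M, TangentSpace 𝓘(ℝ, E) x} {p : M}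
    (hY : MDiffAt (T% Y) p) (u : TangentSpace 𝓘(ℝ, E) p) :
    leviCivita E M (fun x ↦ c • Y x) p u = c • leviCivita E M Y p u :=
  congr($((leviCivita E M).isCovariantDerivativeOnUniv.smul_const c hY) u)

theorem leviCivita_neg {Y : Π x : M, TangentSpace 𝓘(ℝ, E) x} {p : M}
    (hY : MDiffAt (T% Y) p) (u : TangentSpace 𝓘(ℝ, E) p) :
    leviCivita E M (fun x ↦ - Y x) p u = - leviCivita E M Y p u := by
  simpa using leviCivita_const_smul (-1) hY u

theorem leviCivita_sum {ι : Type*} [Fintype ι] {Y : ι → Π x : M, TangentSpace 𝓘(ℝ, E) x} {p : M}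
    (hY : ∀ i, MDiffAt (T% (Y i)) p) (u : TangentSpace 𝓘(ℝ, E) p) :
    leviCivita E M (fun x ↦ ∑ i, Y i x) p u = ∑ i, leviCivita E M (Y i) p u := by
  classical
  suffices h : ∀ s : Finset ι,
      leviCivita E M (fun x ↦ ∑ i ∈ s, Y i x) p u = ∑ i ∈ s, leviCivita E M (Y i) p u from h _
  intro s
  induction s using Finset.induction_on with
  | empty =>
    have := (leviCivita E M).zero
    simp only [Finset.sum_empty]
    exact congr($this p u)
  | insert a s ha ih =>
    simp_rw [Finset.sum_insert ha]
    rw [leviCivita_add (hY a) (MDifferentiableAt.sum_section fun i _ ↦ hY i), ih]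

theorem leviCivita_congr {Y Z : Π x : M, TangentSpace 𝓘(ℝ, E) x} {p : M}
    (hY : MDiffAt (T% Y) p) (h : ∀ᶠ x in 𝓝 p, Y x = Z x) :
    leviCivita E M Y p = leviCivita E M Z p := by
  have hZ : MDiffAt (T% Z) p := hY.congr_of_eventuallyEq (by
    filter_upwards [h] with x hx; rw [hx])
  exact (leviCivita E M).isCovariantDerivativeOnUniv.congr_of_eventuallyEq hY hZ univ_mem h

/-- The Levi-Civita connection is torsion-free. -/
theorem leviCivita_sub_swap {X Y : Π x : M, TangentSpace 𝓘(ℝ, E) x} {p : M}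
    (hX : MDiffAt (T% X) p) (hY : MDiffAt (T% Y) p) :
    mlieBracket 𝓘(ℝ, E) X Y p = leviCivita E M Y p (X p) - leviCivita E M X p (Y p) :=
  ((CovariantDerivative.torsion_eq_zero_iff _).mp leviCivita_torsion_eq_zero hX hY).symm

variable [T2Space M]

/-- `(∇_u L) Y = ∇_u (L Y) - L (∇_u Y)` depends only on the value of `Y` at the point. -/
theorem tensorialAt_covEndo
    {L : Π x : M, TangentSpace 𝓘(ℝ, E) x →L[ℝ] TangentSpace 𝓘(ℝ, E) x}
    (hL : IsSmoothEndo L) (p : M) :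
    TensorialAt 𝓘(ℝ, E) E (fun Y : Π x : M, TangentSpace 𝓘(ℝ, E) x ↦
      leviCivita E M (fun x ↦ L x (Y x)) p - L p ∘L leviCivita E M Y p) p where
  smul {f Y} hf hY := by
    ext u
    have h1 : (fun x ↦ L x ((f • Y) x)) = fun x ↦ f x • L x (Y x) := by ext x; simp
    have h2 := leviCivita_smul hf (hL.mdiffAt hY) u
    have h3 := leviCivita_smul hf hY u
    change leviCivita E M (f • Y) p u = _ at h3
    simp only [h1, _root_.sub_apply, ContinuousLinearMap.comp_apply, h2, h3, map_add, map_smul,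
      _root_.smul_apply]
    module
  add {Y Y'} hY hY' := by
    ext u
    have h1 : (fun x ↦ L x ((Y + Y') x)) = fun x ↦ L x (Y x) + L x (Y' x) := by ext x; simp
    have h2 := leviCivita_add (hL.mdiffAt hY) (hL.mdiffAt hY') u
    have h3 := leviCivita_add hY hY' u
    change leviCivita E M (Y + Y') p u = _ at h3
    simp only [h1, _root_.sub_apply, ContinuousLinearMap.comp_apply, h2, h3, map_add,
      _root_.add_apply]
    module

/-- The covariant derivative of a field `L` of endomorphisms: `covEndo hL p v u = (∇_u L) v`. The
differentiated vector `v` comes first. -/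
def covEndo {L : Π x : M, TangentSpace 𝓘(ℝ, E) x →L[ℝ] TangentSpace 𝓘(ℝ, E) x}
    (hL : IsSmoothEndo L) (p : M) :
    TangentSpace 𝓘(ℝ, E) p →L[ℝ] TangentSpace 𝓘(ℝ, E) p →L[ℝ] TangentSpace 𝓘(ℝ, E) p :=
  TensorialAt.mkHom _ p (tensorialAt_covEndo hL p)

theorem leviCivita_endo {L : Π x : M, TangentSpace 𝓘(ℝ, E) x →L[ℝ] TangentSpace 𝓘(ℝ, E) x}
    (hL : IsSmoothEndo L) {p : M} {Y : Π x : M, TangentSpace 𝓘(ℝ, E) x} (hY : MDiffAt (T% Y) p)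
    (u : TangentSpace 𝓘(ℝ, E) p) :
    leviCivita E M (fun x ↦ L x (Y x)) p u
      = covEndo hL p (Y p) u + L p (leviCivita E M Y p u) := by
  have h := TensorialAt.mkHom_apply (tensorialAt_covEndo hL p) hY
  have h2 : covEndo hL p (Y p) u = _ := congr($h u)
  rw [h2]
  simp

end CovariantCalculus

/-! ### Almost contact metric and contact structures -/

section Sasakian

open Filter Topology

variable {E : Type*} [NormedAddCommGroup E] [NormedSpace ℝ E] [FiniteDimensional ℝ E]
  {M : Type*} [TopologicalSpace M] [ChartedSpace E M] [IsManifold 𝓘(ℝ, E) ∞ M]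
  [RiemannianBundle (fun x : M ↦ TangentSpace 𝓘(ℝ, E) x)]
  [IsContMDiffRiemannianBundle 𝓘(ℝ, E) ∞ E (fun x : M ↦ TangentSpace 𝓘(ℝ, E) x)]
  {φ : Π x : M, TangentSpace 𝓘(ℝ, E) x →L[ℝ] TangentSpace 𝓘(ℝ, E) x}
  {ξ : Π x : M, TangentSpace 𝓘(ℝ, E) x}
  {η : Π x : M, TangentSpace 𝓘(ℝ, E) x →L[ℝ] ℝ}

theorem IsAlmostContactMetric.isSmoothEndo (h : IsAlmostContactMetric φ ξ η) : IsSmoothEndo φ :=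
  fun _ hX ↦ ContMDiff.clm_bundle_apply h.smooth_φ hX

theorem IsAlmostContactMetric.isSmoothField (h : IsAlmostContactMetric φ ξ η) : IsSmoothField ξ :=
  h.smooth_ξ

theorem IsAlmostContactMetric.η_eq_inner (h : IsAlmostContactMetric φ ξ η) (p : M)
    (v : TangentSpace 𝓘(ℝ, E) p) : η p v = inner ℝ v (ξ p) := by
  have h1 := h.inner_φ_φ p v (ξ p)
  rw [h.φ_ξ, h.η_ξ, inner_zero_right] at h1
  linarith

theorem IsAlmostContactMetric.inner_ξ_ξ (h : IsAlmostContactMetric φ ξ η) (p : M) :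
    inner ℝ (ξ p) (ξ p) = (1 : ℝ) := by
  rw [← h.η_eq_inner, h.η_ξ]

theorem IsAlmostContactMetric.η_φ (h : IsAlmostContactMetric φ ξ η) (p : M)
    (v : TangentSpace 𝓘(ℝ, E) p) : η p (φ p v) = 0 := by
  have h1 := h.φ_φ p (φ p v)
  rw [h.φ_φ p v, map_add, map_neg, map_smul, h.φ_ξ, smul_zero, add_zero] at h1
  have h2 : η p (φ p v) • ξ p = 0 := by
    rw [left_eq_add] at h1; exact h1
  have h3 := congr(η p $h2)
  simpa [h.η_ξ] using h3

theorem IsAlmostContactMetric.inner_φ_ξ (h : IsAlmostContactMetric φ ξ η) (p : M)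
    (v : TangentSpace 𝓘(ℝ, E) p) : inner ℝ (φ p v) (ξ p) = (0 : ℝ) := by
  rw [← h.η_eq_inner, h.η_φ]

theorem IsAlmostContactMetric.inner_φ_left (h : IsAlmostContactMetric φ ξ η) (p : M)
    (v w : TangentSpace 𝓘(ℝ, E) p) : inner ℝ (φ p v) w = - inner ℝ v (φ p w) := by
  have h1 := h.inner_φ_φ p v (φ p w)
  rw [h.φ_φ, inner_add_right, inner_neg_right, inner_smul_right, h.inner_φ_ξ, h.η_φ] at h1
  linarith

variable [T2Space M]

theorem inner_covEndo_of_skew {L : Π x : M, TangentSpace 𝓘(ℝ, E) x →L[ℝ] TangentSpace 𝓘(ℝ, E) x}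
    (hL : IsSmoothEndo L) (hskew : ∀ x v w, inner ℝ (L x v) w = - inner ℝ v (L x w)) (p : M)
    (u v w : TangentSpace 𝓘(ℝ, E) p) :
    inner ℝ (covEndo hL p v u) w = - inner ℝ v (covEndo hL p w u) := by
  obtain ⟨X, hX, rfl⟩ := exists_smooth_extension u
  obtain ⟨Y, hY, rfl⟩ := exists_smooth_extension v
  obtain ⟨Z, hZ, rfl⟩ := exists_smooth_extension w
  have h1 := leviCivita_inner (hX.mdiffAt p) ((hL _ hY).mdiffAt p) (hZ.mdiffAt p)
  have h2 := leviCivita_inner (hX.mdiffAt p) (hY.mdiffAt p) ((hL _ hZ).mdiffAt p)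
  have h3 : (fun x ↦ (inner ℝ (L x (Y x)) (Z x) : ℝ)) = - fun x ↦ inner ℝ (Y x) (L x (Z x)) := by
    ext x; exact hskew ..
  rw [h3, mvfderiv_neg] at h1
  simp only [_root_.neg_apply, h2, leviCivita_endo hL (hY.mdiffAt p),
    leviCivita_endo hL (hZ.mdiffAt p), inner_add_left, inner_add_right, hskew] at h1
  linarith

theorem inner_covEndo_of_symm {L : Π x : M, TangentSpace 𝓘(ℝ, E) x →L[ℝ] TangentSpace 𝓘(ℝ, E) x}
    (hL : IsSmoothEndo L) (hsymm : ∀ x v w, inner ℝ (L x v) w = inner ℝ v (L x w)) (p : M)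
    (u v w : TangentSpace 𝓘(ℝ, E) p) :
    inner ℝ (covEndo hL p v u) w = inner ℝ v (covEndo hL p w u) := by
  obtain ⟨X, hX, rfl⟩ := exists_smooth_extension u
  obtain ⟨Y, hY, rfl⟩ := exists_smooth_extension v
  obtain ⟨Z, hZ, rfl⟩ := exists_smooth_extension w
  have h1 := leviCivita_inner (hX.mdiffAt p) ((hL _ hY).mdiffAt p) (hZ.mdiffAt p)
  have h2 := leviCivita_inner (hX.mdiffAt p) (hY.mdiffAt p) ((hL _ hZ).mdiffAt p)
  have h3 : (fun x ↦ (inner ℝ (L x (Y x)) (Z x) : ℝ)) = fun x ↦ inner ℝ (Y x) (L x (Z x)) := by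
    ext x; exact hsymm ..
  rw [h3] at h1
  simp only [h2, leviCivita_endo hL (hY.mdiffAt p),
    leviCivita_endo hL (hZ.mdiffAt p), inner_add_left, inner_add_right, hsymm] at h1
  linarith

theorem IsAlmostContactMetric.inner_leviCivita_ξ_ξ (h : IsAlmostContactMetric φ ξ η) (p : M)
    (u : TangentSpace 𝓘(ℝ, E) p) : inner ℝ (leviCivita E M ξ p u) (ξ p) = (0 : ℝ) := by
  obtain ⟨X, hX, rfl⟩ := exists_smooth_extension u
  have hξ := h.isSmoothField.mdiffAt p
  have h1 := leviCivita_inner (hX.mdiffAt p) hξ hξ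
  simp only [h.inner_ξ_ξ, mvfderiv_const, _root_.zero_apply, real_inner_comm _ (ξ p)] at h1
  linarith

theorem IsAlmostContactMetric.covEndo_ξ (h : IsAlmostContactMetric φ ξ η) (p : M)
    (u : TangentSpace 𝓘(ℝ, E) p) :
    covEndo h.isSmoothEndo p (ξ p) u = - φ p (leviCivita E M ξ p u) := by
  have h1 := leviCivita_endo h.isSmoothEndo (h.isSmoothField.mdiffAt p) u
  have h2 : (fun x ↦ φ x (ξ x)) = fun x ↦ (0 : TangentSpace 𝓘(ℝ, E) x) := by
    ext x; exact h.φ_ξ x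
  have h3 : leviCivita E M (fun x ↦ (0 : TangentSpace 𝓘(ℝ, E) x)) p u = 0 :=
    congr($((leviCivita E M).zero) p u)
  rw [h2, h3] at h1
  exact (neg_eq_of_add_eq_zero_left h1.symm).symm

/-- The derivative of the identity `φ² = -1 + η ⊗ ξ`. -/
theorem IsAlmostContactMetric.inner_covEndo_φ (h : IsAlmostContactMetric φ ξ η) (p : M)
    (u v w : TangentSpace 𝓘(ℝ, E) p) :
    inner ℝ (covEndo h.isSmoothEndo p (φ p v) u) w - inner ℝ (covEndo h.isSmoothEndo p v u) (φ p w)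
      = inner ℝ (leviCivita E M ξ p u) v * η p w + η p v * inner ℝ (leviCivita E M ξ p u) w := by
  obtain ⟨X, hX, rfl⟩ := exists_smooth_extension u
  obtain ⟨Y, hY, rfl⟩ := exists_smooth_extension v
  have hφ := h.isSmoothEndo
  have hξ := h.isSmoothField
  have h1 := leviCivita_endo hφ ((hφ _ hY).mdiffAt p) (X p)
  have h2 : (fun x ↦ φ x (φ x (Y x))) = fun x ↦ - Y x + (inner ℝ (Y x) (ξ x) : ℝ) • ξ x := by
    ext x
    rw [h.φ_φ, h.η_eq_inner]
  rw [h2, leviCivita_add (hY.neg.mdiffAt p) ((hξ.smul (hY.inner hξ)).mdiffAt p),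
    leviCivita_neg (hY.mdiffAt p),
    leviCivita_smul ((hY.inner hξ p).mdifferentiableAt (by simp)) (hξ.mdiffAt p),
    leviCivita_inner (hX.mdiffAt p) (hY.mdiffAt p) (hξ.mdiffAt p),
    leviCivita_endo hφ (hY.mdiffAt p), map_add, h.φ_φ, h.η_eq_inner] at h1
  have h3 := congr(inner ℝ $h1 w)
  simp only [inner_add_left, inner_neg_left, real_inner_smul_left, h.inner_φ_left p _ w] at h3
  rw [h.η_eq_inner, h.η_eq_inner, real_inner_comm (Y p) (leviCivita E M ξ p (X p)),
    real_inner_comm (ξ p) w]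
  linarith

/-- The antisymmetric part of `∇ξ` is `dη`, given by the contact condition. -/
theorem IsSasakian.inner_leviCivita_ξ_sub (h : IsSasakian φ ξ η) (p : M)
    (u v : TangentSpace 𝓘(ℝ, E) p) :
    inner ℝ (leviCivita E M ξ p u) v - inner ℝ (leviCivita E M ξ p v) u
      = 2 * inner ℝ u (φ p v) := by
  obtain ⟨X, hX, rfl⟩ := exists_smooth_extension u
  obtain ⟨Y, hY, rfl⟩ := exists_smooth_extension v
  have hξ := h.isSmoothField
  have h1 := h.contact p X Y (hX.mdiffAt p) (hY.mdiffAt p)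
  simp only [extDeriv, h.η_eq_inner] at h1
  rw [leviCivita_inner (hX.mdiffAt p) (hY.mdiffAt p) (hξ.mdiffAt p),
    leviCivita_inner (hY.mdiffAt p) (hX.mdiffAt p) (hξ.mdiffAt p),
    leviCivita_sub_swap (hX.mdiffAt p) (hY.mdiffAt p), inner_sub_left] at h1
  rw [h1, real_inner_comm (Y p) (leviCivita E M ξ p (X p)),
    real_inner_comm (X p) (leviCivita E M ξ p (Y p))]
  ring

/-- The fundamental two-form `Φ(X, Y) = g(X, φ Y)` of a contact metric structure is closed, being
equal to `dη`; for a torsion-free connection this says that the cyclic sum of `∇Φ` vanishes. -/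
theorem IsSasakian.inner_covEndo_cyclic (h : IsSasakian φ ξ η) (p : M)
    (u v w : TangentSpace 𝓘(ℝ, E) p) :
    inner ℝ (covEndo h.isSmoothEndo p v u) w + inner ℝ (covEndo h.isSmoothEndo p w v) u
      + inner ℝ (covEndo h.isSmoothEndo p u w) v = (0 : ℝ) := by
  have : IsManifold 𝓘(ℝ, E) (minSmoothness ℝ 3) M := by
    rw [minSmoothness_of_isRCLikeNormedField]; infer_instance
  have hmin : (minSmoothness ℝ 2 : ℕ∞ω) ≤ ∞ := by
    rw [minSmoothness_of_isRCLikeNormedField]; exact ENat.LEInfty.out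
  obtain ⟨X, hX, rfl⟩ := exists_smooth_extension u
  obtain ⟨Y, hY, rfl⟩ := exists_smooth_extension v
  obtain ⟨Z, hZ, rfl⟩ := exists_smooth_extension w
  have hφ := h.isSmoothEndo
  have hξ := h.isSmoothField
  have hη {W : Π x : M, TangentSpace 𝓘(ℝ, E) x} (hW : IsSmoothField W) :
      ContMDiff 𝓘(ℝ, E) 𝓘(ℝ, ℝ) ∞ (fun x ↦ η x (W x)) := by
    simp only [h.η_eq_inner]; exact hW.inner hξ
  have hd {k : M → ℝ} (hk : ContMDiff 𝓘(ℝ, E) 𝓘(ℝ, ℝ) ∞ k) : MDiffAt k p :=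
    (hk p).mdifferentiableAt (by simp)
  -- the derivative of `Φ(B, C)` along `A`, computed from `Φ = dη`
  have h1 {A B C : Π x : M, TangentSpace 𝓘(ℝ, E) x} (hA : IsSmoothField A)
      (hB : IsSmoothField B) (hC : IsSmoothField C) :
      2 * mvfderiv 𝓘(ℝ, E) (fun x ↦ inner ℝ (B x) (φ x (C x))) p (A p)
        = mvfderiv 𝓘(ℝ, E) (fun x ↦ mvfderiv 𝓘(ℝ, E) (fun x ↦ η x (C x)) x (B x)) p (A p)
          - mvfderiv 𝓘(ℝ, E) (fun x ↦ mvfderiv 𝓘(ℝ, E) (fun x ↦ η x (B x)) x (C x)) p (A p)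
          - mvfderiv 𝓘(ℝ, E) (fun x ↦ η x (mlieBracket 𝓘(ℝ, E) B C x)) p (A p) := by
    have e1 : (fun x ↦ (inner ℝ (B x) (φ x (C x)) : ℝ)) = (fun _ ↦ (1 / 2 : ℝ)) *
        (((fun x ↦ mvfderiv 𝓘(ℝ, E) (fun x ↦ η x (C x)) x (B x))
          - fun x ↦ mvfderiv 𝓘(ℝ, E) (fun x ↦ η x (B x)) x (C x))
          - fun x ↦ η x (mlieBracket 𝓘(ℝ, E) B C x)) := by
      ext x
      exact h.contact x B C (hB.mdiffAt x) (hC.mdiffAt x)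
    have d1 := hd (contMDiff_mvfderiv_apply (hη hC) hB)
    have d2 := hd (contMDiff_mvfderiv_apply (hη hB) hC)
    have d3 := hd (hη (hB.mlieBracket hC))
    rw [e1, mvfderiv_mul mdifferentiableAt_const ((d1.sub d2).sub d3),
      mvfderiv_sub (d1.sub d2) d3, mvfderiv_sub d1 d2, mvfderiv_const]
    simp only [_root_.sub_apply, _root_.smul_apply, smul_zero, add_zero, smul_eq_mul]
    ring
  -- the same derivative, computed by the Levi-Civita connection
  have h2 {A B C : Π x : M, TangentSpace 𝓘(ℝ, E) x} (hA : IsSmoothField A)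
      (hB : IsSmoothField B) (hC : IsSmoothField C) :
      mvfderiv 𝓘(ℝ, E) (fun x ↦ inner ℝ (B x) (φ x (C x))) p (A p)
        = inner ℝ (leviCivita E M B p (A p)) (φ p (C p))
          + inner ℝ (B p) (covEndo hφ p (C p) (A p))
          + inner ℝ (B p) (φ p (leviCivita E M C p (A p))) := by
    rw [leviCivita_inner (hA.mdiffAt p) (hB.mdiffAt p) ((hφ _ hC).mdiffAt p),
      leviCivita_endo hφ (hC.mdiffAt p), inner_add_right]
    ring
  have h3 {A B C : Π x : M, TangentSpace 𝓘(ℝ, E) x} (hA : IsSmoothField A)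
      (hB : IsSmoothField B) (hC : IsSmoothField C) :=
    h.contact p _ C ((hA.mlieBracket hB).mdiffAt p) (hC.mdiffAt p)
  have h4 {A B C : Π x : M, TangentSpace 𝓘(ℝ, E) x} (hA : IsSmoothField A)
      (hB : IsSmoothField B) (hC : IsSmoothField C) :=
    mvfderiv_mlieBracket (hη hC) hA hB p
  have jac := congr(η p $(leibniz_identity_mlieBracket_apply ((hX p).of_le hmin)
    ((hY p).of_le hmin) ((hZ p).of_le hmin)))
  have b1 : mlieBracket 𝓘(ℝ, E) (mlieBracket 𝓘(ℝ, E) X Y) Z p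
      = - mlieBracket 𝓘(ℝ, E) Z (mlieBracket 𝓘(ℝ, E) X Y) p := mlieBracket_swap_apply
  have b2 : mlieBracket 𝓘(ℝ, E) (mlieBracket 𝓘(ℝ, E) Y Z) X p
      = - mlieBracket 𝓘(ℝ, E) X (mlieBracket 𝓘(ℝ, E) Y Z) p := mlieBracket_swap_apply
  have b4 : mlieBracket 𝓘(ℝ, E) X Z = - mlieBracket 𝓘(ℝ, E) Z X := mlieBracket_swap
  have b3 : mlieBracket 𝓘(ℝ, E) (mlieBracket 𝓘(ℝ, E) Z X) Y p
      = mlieBracket 𝓘(ℝ, E) Y (mlieBracket 𝓘(ℝ, E) X Z) p := by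
    rw [mlieBracket_swap_apply, b4]
    have := mlieBracket_const_smul_right (I := 𝓘(ℝ, E)) (V := Y) (c := (-1 : ℝ))
      ((hZ.mlieBracket hX).mdiffAt p)
    simpa using this.symm
  rw [map_add] at jac
  have c1 := h3 hX hY hZ
  have c2 := h3 hY hZ hX
  have c3 := h3 hZ hX hY
  simp only [extDeriv, h4 hX hY hZ, h4 hY hZ hX, h4 hZ hX hY, b2, b3, map_neg] at c1 c2 c3
  simp only [leviCivita_sub_swap (hX.mdiffAt p) (hY.mdiffAt p),
    leviCivita_sub_swap (hY.mdiffAt p) (hZ.mdiffAt p),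
    leviCivita_sub_swap (hZ.mdiffAt p) (hX.mdiffAt p), inner_sub_left] at c1 c2 c3
  rw [b1] at jac
  rw [b1] at c1
  rw [map_neg] at jac c1
  have d1 := h1 hX hY hZ
  have d2 := h1 hY hZ hX
  have d3 := h1 hZ hX hY
  rw [h2 hX hY hZ] at d1
  rw [h2 hY hZ hX] at d2
  rw [h2 hZ hX hY] at d3
  -- collect the terms by the antisymmetry of `Φ` and `∇Φ`
  have s (v w : TangentSpace 𝓘(ℝ, E) p) : inner ℝ v (φ p w) = - inner ℝ w (φ p v) := by
    rw [← h.inner_φ_left, real_inner_comm]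
  have t (u v w : TangentSpace 𝓘(ℝ, E) p) :
      inner ℝ (covEndo hφ p v u) w = - inner ℝ v (covEndo hφ p w u) :=
    inner_covEndo_of_skew hφ h.inner_φ_left p u v w
  rw [t, t, t]
  rw [s (Y p) (leviCivita E M Z p (X p))] at d1
  rw [s (Z p) (leviCivita E M X p (Y p))] at d2
  rw [s (X p) (leviCivita E M Y p (Z p))] at d3
  linarith

end Sasakian

/-! ### The covariant derivative of the structure tensors of a Sasakian manifold -/

section SasakianIdentities

variable {E : Type*} [NormedAddCommGroup E] [NormedSpace ℝ E] [FiniteDimensional ℝ E]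
  {M : Type*} [TopologicalSpace M] [ChartedSpace E M] [IsManifold 𝓘(ℝ, E) ∞ M] [T2Space M]
  [RiemannianBundle (fun x : M ↦ TangentSpace 𝓘(ℝ, E) x)]
  [IsContMDiffRiemannianBundle 𝓘(ℝ, E) ∞ E (fun x : M ↦ TangentSpace 𝓘(ℝ, E) x)]
  {φ : Π x : M, TangentSpace 𝓘(ℝ, E) x →L[ℝ] TangentSpace 𝓘(ℝ, E) x}
  {ξ : Π x : M, TangentSpace 𝓘(ℝ, E) x}
  {η : Π x : M, TangentSpace 𝓘(ℝ, E) x →L[ℝ] ℝ}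

/-- The normality condition, expressed by the covariant derivative of `φ`. -/
theorem IsSasakian.nijenhuis_covEndo (h : IsSasakian φ ξ η) (p : M)
    (u v : TangentSpace 𝓘(ℝ, E) p) :
    covEndo h.isSmoothEndo p v (φ p u) - covEndo h.isSmoothEndo p u (φ p v)
      - φ p (covEndo h.isSmoothEndo p v u) + φ p (covEndo h.isSmoothEndo p u v)
      + (2 * inner ℝ u (φ p v)) • ξ p = 0 := by
  obtain ⟨X, hX, rfl⟩ := exists_smooth_extension u
  obtain ⟨Y, hY, rfl⟩ := exists_smooth_extension v
  have hφ := h.isSmoothEndo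
  have dX := hX.mdiffAt p
  have dY := hY.mdiffAt p
  have dφX := (hφ _ hX).mdiffAt p
  have dφY := (hφ _ hY).mdiffAt p
  have h1 := h.normal p X Y dX dY
  rw [← h.contact p X Y dX dY, nijenhuis, leviCivita_sub_swap dX dY, leviCivita_sub_swap dφX dφY,
    leviCivita_sub_swap dφX dY, leviCivita_sub_swap dX dφY] at h1
  simp only [leviCivita_endo hφ dX, leviCivita_endo hφ dY, map_sub, map_add] at h1
  rw [← h1]
  module

/-- `ξ` is a Killing field, so that `∇ξ` is equal to its antisymmetric part `dη`. -/
theorem IsSasakian.inner_leviCivita_ξ (h : IsSasakian φ ξ η) (p : M)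
    (u v : TangentSpace 𝓘(ℝ, E) p) :
    inner ℝ (leviCivita E M ξ p u) v = inner ℝ u (φ p v) := by
  have hφ := h.isSmoothEndo
  have sk := h.inner_φ_left p
  have aξ := h.inner_leviCivita_ξ_ξ p
  have ξa (w) : inner ℝ (leviCivita E M ξ p (ξ p)) w = (0 : ℝ) := by
    have h1 := h.inner_leviCivita_ξ_sub p (ξ p) w
    rw [aξ, real_inner_comm (φ p w) (ξ p), h.inner_φ_ξ] at h1
    linarith
  have ξ0 : leviCivita E M ξ p (ξ p) = 0 := inner_self_eq_zero.mp (ξa _)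
  have t (a b c : TangentSpace 𝓘(ℝ, E) p) :
      inner ℝ (covEndo hφ p b a) c = - inner ℝ b (covEndo hφ p c a) :=
    inner_covEndo_of_skew hφ h.inner_φ_left p a b c
  -- normality at `(x, ξ)` and closedness of `Φ` at `(ξ, x, w)`: `∇ξ` is antisymmetric on the
  -- image of `φ`, which together with `ξ` spans the tangent space
  have key (x w : TangentSpace 𝓘(ℝ, E) p) :
      inner ℝ (leviCivita E M ξ p (φ p x)) w = - inner ℝ (leviCivita E M ξ p w) (φ p x) := by
    have n := congr(inner ℝ $(h.nijenhuis_covEndo p x (ξ p)) (φ p w))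
    have c := h.inner_covEndo_cyclic p (ξ p) x w
    rw [h.φ_ξ] at n
    simp only [map_zero, inner_add_left, inner_sub_left, inner_zero_left, inner_zero_right,
      real_inner_smul_left, h.covEndo_ξ, map_neg, inner_neg_left, h.inner_φ_φ, h.η_φ,
      h.η_eq_inner, aξ, sk _ w] at n
    rw [h.covEndo_ξ, t x w, h.covEndo_ξ, inner_neg_left, inner_neg_right, sk,
      real_inner_comm _ w, sk] at c
    have e : inner ℝ (covEndo hφ p x (ξ p)) (ξ p) = (0 : ℝ) := by
      rw [t, h.covEndo_ξ, ξ0, map_zero, neg_zero, inner_zero_right, neg_zero]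
    rw [e] at n
    linarith
  have key2 := key (φ p v) u
  rw [h.φ_φ, map_add, map_neg, map_smul, ξ0, inner_add_left, inner_neg_left, smul_zero,
    inner_zero_left, inner_add_right, inner_neg_right, inner_smul_right, aξ] at key2
  have := h.inner_leviCivita_ξ_sub p u v
  linarith

/-- `∇_u ξ = -φ u`. -/
theorem IsSasakian.leviCivita_ξ (h : IsSasakian φ ξ η) (p : M) (u : TangentSpace 𝓘(ℝ, E) p) :
    leviCivita E M ξ p u = - φ p u := by
  refine ext_inner_right ℝ fun w ↦ ?_
  rw [h.inner_leviCivita_ξ, inner_neg_left, h.inner_φ_left, neg_neg]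

/-- `(∇_u φ) v = g(u, v) ξ - η(v) u`. As for the Koszul formula, `∇φ` is determined by normality and
the closedness of `Φ`: add the cyclic identities at `(u, v, w)` and `(u, φ v, φ w)` and move `φ`
across by the derivative of `φ² = -1 + η ⊗ ξ`. -/
theorem IsSasakian.covEndo_φ (h : IsSasakian φ ξ η) (p : M) (u v : TangentSpace 𝓘(ℝ, E) p) :
    covEndo h.isSmoothEndo p v u = (inner ℝ u v : ℝ) • ξ p - η p v • u := by
  refine ext_inner_right ℝ fun w ↦ ?_
  have hφ := h.isSmoothEndo
  have sk := h.inner_φ_left p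
  have t (a b c : TangentSpace 𝓘(ℝ, E) p) :
      inner ℝ (covEndo hφ p b a) c = - inner ℝ (covEndo hφ p c a) b := by
    rw [real_inner_comm b]
    exact inner_covEndo_of_skew hφ h.inner_φ_left p a b c
  have d (a b c : TangentSpace 𝓘(ℝ, E) p) := h.inner_covEndo_φ p a b c
  have tξ (a b : TangentSpace 𝓘(ℝ, E) p) : inner ℝ (covEndo hφ p b a) (ξ p)
      = inner ℝ a b - η p a * η p b := by
    rw [t, h.covEndo_ξ, inner_neg_left, neg_neg, h.leviCivita_ξ, map_neg, inner_neg_left, sk,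
      neg_neg, h.inner_φ_φ]
  have iξ (a : TangentSpace 𝓘(ℝ, E) p) : inner ℝ a (ξ p) = η p a := (h.η_eq_inner p a).symm
  have n := congr(inner ℝ $(h.nijenhuis_covEndo p v w) (φ p u))
  simp only [inner_add_left, inner_sub_left, inner_zero_left, real_inner_smul_left, h.inner_φ_φ,
    real_inner_comm (φ p u) (ξ p), h.inner_φ_ξ] at n
  rw [h.η_eq_inner p (covEndo hφ p w v), h.η_eq_inner p (covEndo hφ p v w), tξ, tξ,
    real_inner_comm v w] at n
  have c1 := h.inner_covEndo_cyclic p u v w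
  have c2 := h.inner_covEndo_cyclic p u (φ p v) (φ p w)
  have d1 := d u v (φ p w)
  have d2 := d (φ p v) w u
  have d3 := d (φ p w) v u
  have t1 := t w u v
  have t2 := t (φ p w) u (φ p v)
  simp only [h.inner_leviCivita_ξ, h.φ_φ, inner_add_right, inner_neg_right, inner_smul_right, tξ,
    h.η_φ, h.inner_φ_φ, iξ] at d1 d2 d3
  rw [real_inner_comm v w, real_inner_comm u w] at d3
  rw [real_inner_comm u v] at d2
  rw [inner_sub_left, real_inner_smul_left, real_inner_smul_left, real_inner_comm w (ξ p), iξ]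
  linarith

end SasakianIdentities

/-! ### Riemannian submersions and O'Neill's tensors -/

section EndomorphismCalculus

variable {E : Type*} [NormedAddCommGroup E] [NormedSpace ℝ E] [FiniteDimensional ℝ E]
  {M : Type*} [TopologicalSpace M] [ChartedSpace E M] [IsManifold 𝓘(ℝ, E) ∞ M] [T2Space M]
  [RiemannianBundle (fun x : M ↦ TangentSpace 𝓘(ℝ, E) x)]
  [IsContMDiffRiemannianBundle 𝓘(ℝ, E) ∞ E (fun x : M ↦ TangentSpace 𝓘(ℝ, E) x)]

theorem covEndo_comp {A B : Π x : M, TangentSpace 𝓘(ℝ, E) x →L[ℝ] TangentSpace 𝓘(ℝ, E) x}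
    (hA : IsSmoothEndo A) (hB : IsSmoothEndo B) (p : M) (u v : TangentSpace 𝓘(ℝ, E) p) :
    covEndo (hA.comp hB) p v u = covEndo hA p (B p v) u + A p (covEndo hB p v u) := by
  obtain ⟨Y, hY, rfl⟩ := exists_smooth_extension v
  have h1 := leviCivita_endo (hA.comp hB) (hY.mdiffAt p) u
  have h2 := leviCivita_endo hA ((hB _ hY).mdiffAt p) u
  have h3 := leviCivita_endo hB (hY.mdiffAt p) u
  simp only [ContinuousLinearMap.comp_apply] at h1
  rw [h1, h3, map_add, ← add_assoc] at h2
  exact add_right_cancel h2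

theorem covEndo_congr {A B : Π x : M, TangentSpace 𝓘(ℝ, E) x →L[ℝ] TangentSpace 𝓘(ℝ, E) x}
    (hA : IsSmoothEndo A) (hB : IsSmoothEndo B) (h : A = B) (p : M) :
    covEndo hA p = covEndo hB p := by
  subst h; rfl

/-- If `A + B` is the identity, then `∇B = -∇A`. -/
theorem covEndo_of_add_eq_id
    {A B : Π x : M, TangentSpace 𝓘(ℝ, E) x →L[ℝ] TangentSpace 𝓘(ℝ, E) x}
    (hA : IsSmoothEndo A) (hB : IsSmoothEndo B) (h : ∀ x v, A x v + B x v = v) (p : M)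
    (u v : TangentSpace 𝓘(ℝ, E) p) : covEndo hB p v u = - covEndo hA p v u := by
  obtain ⟨Y, hY, rfl⟩ := exists_smooth_extension v
  have h1 := leviCivita_add ((hA _ hY).mdiffAt p) ((hB _ hY).mdiffAt p) u
  simp only [h] at h1
  rw [leviCivita_endo hA (hY.mdiffAt p) u, leviCivita_endo hB (hY.mdiffAt p) u,
    add_add_add_comm, h, right_eq_add] at h1
  exact eq_neg_of_add_eq_zero_right h1

end EndomorphismCalculus

section Projections

variable {E : Type*} [NormedAddCommGroup E] [NormedSpace ℝ E] [FiniteDimensional ℝ E]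
  {M : Type*} [TopologicalSpace M] [ChartedSpace E M] [IsManifold 𝓘(ℝ, E) ∞ M]
  [RiemannianBundle (fun x : M ↦ TangentSpace 𝓘(ℝ, E) x)]
  {E' : Type*} [NormedAddCommGroup E'] [NormedSpace ℝ E']
  {N : Type*} [TopologicalSpace N] [ChartedSpace E' N]
  (proj : M → N) (p : M)

theorem vert_add_hor (v : TangentSpace 𝓘(ℝ, E) p) :
    vert E E' proj p v + hor E E' proj p v = v :=
  Submodule.starProjection_add_starProjection_orthogonal v

theorem vert_mem (v : TangentSpace 𝓘(ℝ, E) p) :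
    vert E E' proj p v ∈ verticalSpace E E' proj p :=
  Submodule.starProjection_apply_mem _ v

theorem hor_mem (v : TangentSpace 𝓘(ℝ, E) p) :
    hor E E' proj p v ∈ horizontalSpace E E' proj p :=
  Submodule.starProjection_apply_mem _ v

variable {proj p}

theorem vert_eq_self {v : TangentSpace 𝓘(ℝ, E) p} (hv : v ∈ verticalSpace E E' proj p) :
    vert E E' proj p v = v :=
  Submodule.starProjection_eq_self_iff.mpr hv

theorem hor_eq_self {v : TangentSpace 𝓘(ℝ, E) p} (hv : v ∈ horizontalSpace E E' proj p) :
    hor E E' proj p v = v :=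
  Submodule.starProjection_eq_self_iff.mpr hv

theorem vert_eq_zero {v : TangentSpace 𝓘(ℝ, E) p} (hv : v ∈ horizontalSpace E E' proj p) :
    vert E E' proj p v = 0 := by
  have := vert_add_hor (E' := E') proj p v
  rwa [hor_eq_self hv, add_eq_right] at this

theorem hor_eq_zero {v : TangentSpace 𝓘(ℝ, E) p} (hv : v ∈ verticalSpace E E' proj p) :
    hor E E' proj p v = 0 := by
  have := vert_add_hor (E' := E') proj p v
  rwa [vert_eq_self hv, add_eq_left] at this

theorem inner_vertical_horizontal {v w : TangentSpace 𝓘(ℝ, E) p}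
    (hv : v ∈ verticalSpace E E' proj p) (hw : w ∈ horizontalSpace E E' proj p) :
    inner ℝ v w = (0 : ℝ) :=
  Submodule.inner_right_of_mem_orthogonal hv hw

theorem inner_horizontal_vertical {v w : TangentSpace 𝓘(ℝ, E) p}
    (hv : v ∈ horizontalSpace E E' proj p) (hw : w ∈ verticalSpace E E' proj p) :
    inner ℝ v w = (0 : ℝ) :=
  Submodule.inner_left_of_mem_orthogonal hw hv

variable (proj p) in
theorem inner_vert_left (v w : TangentSpace 𝓘(ℝ, E) p) :
    inner ℝ (vert E E' proj p v) w = inner ℝ v (vert E E' proj p w) :=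
  Submodule.inner_starProjection_left_eq_right _ v w

variable (proj p) in
theorem inner_hor_left (v w : TangentSpace 𝓘(ℝ, E) p) :
    inner ℝ (hor E E' proj p v) w = inner ℝ v (hor E E' proj p w) :=
  Submodule.inner_starProjection_left_eq_right _ v w

theorem mfderiv_hor (v : TangentSpace 𝓘(ℝ, E) p) :
    mfderiv 𝓘(ℝ, E) 𝓘(ℝ, E') proj p (hor E E' proj p v) = mfderiv 𝓘(ℝ, E) 𝓘(ℝ, E') proj p v := by
  have h : mfderiv 𝓘(ℝ, E) 𝓘(ℝ, E') proj p (vert E E' proj p v) = 0 := vert_mem proj p v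
  conv_rhs => rw [← vert_add_hor (E' := E') proj p v, map_add, h, zero_add]

end Projections

section RiemannianSubmersion

variable {E : Type*} [NormedAddCommGroup E] [NormedSpace ℝ E] [FiniteDimensional ℝ E]
  {M : Type*} [TopologicalSpace M] [ChartedSpace E M] [IsManifold 𝓘(ℝ, E) ∞ M] [T2Space M]
  [RiemannianBundle (fun x : M ↦ TangentSpace 𝓘(ℝ, E) x)]
  [IsContMDiffRiemannianBundle 𝓘(ℝ, E) ∞ E (fun x : M ↦ TangentSpace 𝓘(ℝ, E) x)]
  {E' : Type*} [NormedAddCommGroup E'] [NormedSpace ℝ E']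
  {N : Type*} [TopologicalSpace N] [ChartedSpace E' N] [IsManifold 𝓘(ℝ, E') ∞ N]
  [RiemannianBundle (fun x : N ↦ TangentSpace 𝓘(ℝ, E') x)]
  [IsContMDiffRiemannianBundle 𝓘(ℝ, E') ∞ E' (fun x : N ↦ TangentSpace 𝓘(ℝ, E') x)]
  {proj : M → N}

/-- The horizontal projection is smooth because `g(ℋ v, w) = g_N(proj_* v, proj_* w)`. -/
theorem IsRiemannianSubmersion.isSmoothEndo_hor (h : IsRiemannianSubmersion E E' proj) :
    IsSmoothEndo (hor E E' proj) := by
  intro X hX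
  refine isSmoothField_of_inner fun W hW ↦ ?_
  have h1 : (fun x ↦ (inner ℝ (hor E E' proj x (X x)) (W x) : ℝ)) = fun x ↦
      inner ℝ (mfderiv 𝓘(ℝ, E) 𝓘(ℝ, E') proj x (X x)) (mfderiv 𝓘(ℝ, E) 𝓘(ℝ, E') proj x (W x)) := by
    ext x
    rw [← mfderiv_hor (X x), ← mfderiv_hor (W x),
      ← h.inner_mfderiv x _ (hor_mem proj x _) _ (hor_mem proj x _), ← inner_hor_left,
      hor_eq_self (hor_mem proj x _)]
  rw [h1]
  exact ContMDiff.inner_bundle (E := fun x : N ↦ TangentSpace 𝓘(ℝ, E') x) (b := proj)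
    ((h.contMDiff.contMDiff_tangentMap (m := ∞) (by simp)).comp hX)
    ((h.contMDiff.contMDiff_tangentMap (m := ∞) (by simp)).comp hW)

theorem IsRiemannianSubmersion.isSmoothEndo_vert (h : IsRiemannianSubmersion E E' proj) :
    IsSmoothEndo (vert E E' proj) := by
  intro X hX
  have h1 : (fun x ↦ vert E E' proj x (X x)) = fun x ↦ X x - hor E E' proj x (X x) := by
    ext x
    exact eq_sub_of_add_eq (vert_add_hor ..)
  rw [h1]
  exact hX.sub (h.isSmoothEndo_hor X hX)

theorem IsRiemannianSubmersion.covEndo_hor (h : IsRiemannianSubmersion E E' proj) (p : M)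
    (u v : TangentSpace 𝓘(ℝ, E) p) :
    covEndo h.isSmoothEndo_hor p v u = - covEndo h.isSmoothEndo_vert p v u :=
  covEndo_of_add_eq_id _ _ (fun x v ↦ vert_add_hor proj x v) p u v

theorem IsRiemannianSubmersion.inner_covEndo_comm (h : IsRiemannianSubmersion E E' proj) (p : M)
    (u v w : TangentSpace 𝓘(ℝ, E) p) :
    inner ℝ (covEndo h.isSmoothEndo_vert p v u) w
      = inner ℝ (covEndo h.isSmoothEndo_vert p w u) v := by
  rw [real_inner_comm v]
  exact inner_covEndo_of_symm _ (fun x ↦ inner_vert_left proj x) p u v w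

/-- The derivative of the identity `𝒱² = 𝒱`. -/
theorem IsRiemannianSubmersion.covEndo_vert_idem (h : IsRiemannianSubmersion E E' proj) (p : M)
    (u v : TangentSpace 𝓘(ℝ, E) p) :
    covEndo h.isSmoothEndo_vert p v u = covEndo h.isSmoothEndo_vert p (vert E E' proj p v) u
      + vert E E' proj p (covEndo h.isSmoothEndo_vert p v u) := by
  have hP := h.isSmoothEndo_vert
  rw [← covEndo_comp hP hP]
  refine congr($(covEndo_congr hP (hP.comp hP) ?_ p) v u)
  ext x v
  exact (vert_eq_self (vert_mem proj x v)).symm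

/-- The derivative of the vertical projection maps vertical vectors to horizontal ones. -/
theorem IsRiemannianSubmersion.covEndo_vert_mem (h : IsRiemannianSubmersion E E' proj) {p : M}
    (u : TangentSpace 𝓘(ℝ, E) p) {v : TangentSpace 𝓘(ℝ, E) p}
    (hv : v ∈ verticalSpace E E' proj p) :
    covEndo h.isSmoothEndo_vert p v u ∈ horizontalSpace E E' proj p := by
  have h1 := h.covEndo_vert_idem p u v
  rw [vert_eq_self hv, left_eq_add] at h1
  have h2 := vert_add_hor (E' := E') proj p (covEndo h.isSmoothEndo_vert p v u)
  rw [h1, zero_add] at h2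
  rw [← h2]
  exact hor_mem proj p _

/-- The derivative of the vertical projection maps horizontal vectors to vertical ones. -/
theorem IsRiemannianSubmersion.covEndo_vert_mem' (h : IsRiemannianSubmersion E E' proj) {p : M}
    (u : TangentSpace 𝓘(ℝ, E) p) {v : TangentSpace 𝓘(ℝ, E) p}
    (hv : v ∈ horizontalSpace E E' proj p) :
    covEndo h.isSmoothEndo_vert p v u ∈ verticalSpace E E' proj p := by
  have h1 := h.covEndo_vert_idem p u v
  rw [vert_eq_zero hv, map_zero, _root_.zero_apply, zero_add] at h1
  rw [h1]
  exact vert_mem proj p _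

theorem IsRiemannianSubmersion.inner_covEndo_self (h : IsRiemannianSubmersion E E' proj) (p : M)
    (u v : TangentSpace 𝓘(ℝ, E) p) :
    inner ℝ (covEndo h.isSmoothEndo_vert p v u) v
      = 2 * inner ℝ (covEndo h.isSmoothEndo_vert p (vert E E' proj p v) u) (hor E E' proj p v) := by
  conv_lhs => rw [← vert_add_hor (E' := E') proj p v]
  rw [map_add, _root_.add_apply, inner_add_left, inner_add_right, inner_add_right,
    inner_horizontal_vertical (h.covEndo_vert_mem u (vert_mem proj p v)) (vert_mem proj p v),
    inner_vertical_horizontal (h.covEndo_vert_mem' u (hor_mem proj p v)) (hor_mem proj p v),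
    h.inner_covEndo_comm p u (hor E E' proj p v)]
  ring

/-- Paired with horizontal vectors, O'Neill's tensor `𝒯` is the derivative of the vertical projection
in vertical directions. -/
theorem IsRiemannianSubmersion.inner_oneillT (h : IsRiemannianSubmersion E E' proj) {p : M}
    (u : TangentSpace 𝓘(ℝ, E) p) {v w : TangentSpace 𝓘(ℝ, E) p}
    (hw : w ∈ horizontalSpace E E' proj p) :
    inner ℝ (oneillT E E' proj p u v) w
      = inner ℝ (covEndo h.isSmoothEndo_vert p v (vert E E' proj p u)) w := by
  rw [oneillT, inner_add_left, inner_vertical_horizontal (vert_mem proj p _) hw, inner_hor_left,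
    hor_eq_self hw, leviCivita_endo h.isSmoothEndo_vert (mdifferentiableAt_extend _ _ v),
    inner_add_left, inner_vertical_horizontal (vert_mem proj p _) hw, extend_apply_self]
  ring

/-- Paired with horizontal vectors, O'Neill's tensor `𝒜` is the derivative of the vertical projection
in horizontal directions. -/
theorem IsRiemannianSubmersion.inner_oneillA (h : IsRiemannianSubmersion E E' proj) {p : M}
    (u : TangentSpace 𝓘(ℝ, E) p) {v w : TangentSpace 𝓘(ℝ, E) p}
    (hw : w ∈ horizontalSpace E E' proj p) :
    inner ℝ (oneillA E E' proj p u v) w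
      = inner ℝ (covEndo h.isSmoothEndo_vert p v (hor E E' proj p u)) w := by
  rw [oneillA, inner_add_left, inner_vertical_horizontal (vert_mem proj p _) hw, inner_hor_left,
    hor_eq_self hw, leviCivita_endo h.isSmoothEndo_vert (mdifferentiableAt_extend _ _ v),
    inner_add_left, inner_vertical_horizontal (vert_mem proj p _) hw, extend_apply_self]
  ring

variable {φ : Π x : M, TangentSpace 𝓘(ℝ, E) x →L[ℝ] TangentSpace 𝓘(ℝ, E) x}
  {ξ : Π x : M, TangentSpace 𝓘(ℝ, E) x}
  {η : Π x : M, TangentSpace 𝓘(ℝ, E) x →L[ℝ] ℝ}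

theorem η_vertical (hS : IsSasakian φ ξ η) (hξ : ∀ p, ξ p ∈ horizontalSpace E E' proj p) {p : M}
    {v : TangentSpace 𝓘(ℝ, E) p} (hv : v ∈ verticalSpace E E' proj p) : η p v = 0 := by
  rw [hS.η_eq_inner, inner_vertical_horizontal hv (hξ p)]

/-- The right-hand side of the Clairaut equation at a velocity vector `u` is
`-½ g((∇_u 𝒱) u, u)`; for the velocity of a geodesic this is `-½` times the derivative of
`‖𝒱 α̇‖²`. The term with `∇(ℋ φ ℋ)` is expanded by the product rule: the part containing `∇ℋ` on the
left cancels against O'Neill's tensors, the one with `∇φ` against `η(ℋ u) ℋ u`, and the one containing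
`∇ℋ` on the right remains. -/
theorem clairaut_rhs_eq (hS : IsSasakian φ ξ η) (h : IsAntiInvariantSubmersion E E' φ proj)
    (hξ : ∀ p, ξ p ∈ horizontalSpace E E' proj p) (p : M) (u : TangentSpace 𝓘(ℝ, E) p) :
    inner ℝ
      (η p (hor E E' proj p u) • hor E E' proj p u
        + hor E E' proj p (covEndo (h.isSmoothEndo_hor.comp
            (hS.isSmoothEndo.comp h.isSmoothEndo_hor)) p u u)
        + (oneillT E E' proj p (vert E E' proj p u) (vert E E' proj p (φ p (hor E E' proj p u)))
          + oneillA E E' proj p (hor E E' proj p u)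
            (vert E E' proj p (φ p (hor E E' proj p u)))))
      (φ p (vert E E' proj p u))
      = - (1 / 2) * inner ℝ (covEndo h.isSmoothEndo_vert p u u) u := by
  set V := vert E E' proj p u with hV
  set X := hor E E' proj p u with hX
  have hVm : V ∈ verticalSpace E E' proj p := vert_mem proj p u
  have hXm : X ∈ horizontalSpace E E' proj p := hor_mem proj p u
  have hφV := h.anti_invariant p V hVm
  have hu : u = V + X := (vert_add_hor proj p u).symm
  have hP := h.isSmoothEndo_vert
  have hsplit := vert_add_hor (E' := E') proj p (φ p X)
  set B := vert E E' proj p (φ p X)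
  set C := hor E E' proj p (φ p X)
  have hC : C ∈ horizontalSpace E E' proj p := hor_mem proj p _
  have e1 : inner ℝ (covEndo hP p C u) (φ p V) = (0 : ℝ) :=
    inner_vertical_horizontal (h.covEndo_vert_mem' u hC) hφV
  have e2 : inner ℝ (covEndo hP p B V) (φ p V) + inner ℝ (covEndo hP p B X) (φ p V)
      = (inner ℝ (covEndo hP p B u) (φ p V) : ℝ) := by
    conv_rhs => rw [hu, map_add, inner_add_left]
  have e3 : inner ℝ u (φ p V) = (inner ℝ X (φ p V) : ℝ) := by
    conv_lhs => rw [hu, inner_add_left, inner_vertical_horizontal hVm hφV, zero_add]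
  rw [inner_add_left, inner_add_left, inner_add_left, h.inner_oneillT V hφV, h.inner_oneillA X hφV,
    hor_eq_self (hor_mem proj p u), vert_eq_self (vert_mem proj p u), ← hV, ← hX, e2,
    inner_hor_left, hor_eq_self hφV,
    covEndo_comp h.isSmoothEndo_hor (hS.isSmoothEndo.comp h.isSmoothEndo_hor),
    covEndo_comp hS.isSmoothEndo h.isSmoothEndo_hor, h.covEndo_hor, h.covEndo_hor,
    map_neg, map_add, map_neg, inner_add_left, inner_add_left, inner_neg_left, inner_neg_left,
    inner_hor_left, inner_hor_left, hor_eq_self hφV, hS.inner_φ_φ, η_vertical hS hξ hVm,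
    ContinuousLinearMap.comp_apply, ← hX, ← hsplit, map_add, _root_.add_apply, inner_add_left, e1,
    hS.covEndo_φ, inner_sub_left, real_inner_smul_left, real_inner_smul_left,
    real_inner_smul_left, e3, real_inner_comm (φ p V) (ξ p), hS.inner_φ_ξ, h.inner_covEndo_self,
    ← hV, ← hX, h.inner_covEndo_comm p u u V]
  have e4 : inner ℝ (covEndo hP p V u) u = (inner ℝ (covEndo hP p V u) X : ℝ) := by
    conv_lhs => rw [hu]
    rw [inner_add_right, ← hu, inner_horizontal_vertical (h.covEndo_vert_mem u hVm) hVm, zero_add]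
  rw [e4]
  ring

end RiemannianSubmersion

/-! ### Rigidity of anti-invariant Clairaut submersions -/

section Rigidity

variable {E : Type*} [NormedAddCommGroup E] [NormedSpace ℝ E] [FiniteDimensional ℝ E]
  {M : Type*} [TopologicalSpace M] [ChartedSpace E M] [IsManifold 𝓘(ℝ, E) ∞ M] [T2Space M]
  [RiemannianBundle (fun x : M ↦ TangentSpace 𝓘(ℝ, E) x)]
  [IsContMDiffRiemannianBundle 𝓘(ℝ, E) ∞ E (fun x : M ↦ TangentSpace 𝓘(ℝ, E) x)]
  {E' : Type*} [NormedAddCommGroup E'] [NormedSpace ℝ E'] [FiniteDimensional ℝ E']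
  {N : Type*} [TopologicalSpace N] [ChartedSpace E' N] [IsManifold 𝓘(ℝ, E') ∞ N]
  [RiemannianBundle (fun x : N ↦ TangentSpace 𝓘(ℝ, E') x)]
  [IsContMDiffRiemannianBundle 𝓘(ℝ, E') ∞ E' (fun x : N ↦ TangentSpace 𝓘(ℝ, E') x)]
  {proj : M → N}
  {φ : Π x : M, TangentSpace 𝓘(ℝ, E) x →L[ℝ] TangentSpace 𝓘(ℝ, E) x}
  {ξ : Π x : M, TangentSpace 𝓘(ℝ, E) x}
  {η : Π x : M, TangentSpace 𝓘(ℝ, E) x →L[ℝ] ℝ}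

/-- The fibres have positive dimension, because `dim M > dim N`. -/
theorem IsRiemannianSubmersion.exists_vertical_ne_zero (h : IsRiemannianSubmersion E E' proj)
    (p : M) : ∃ v ∈ verticalSpace E E' proj p, v ≠ 0 := by
  have : FiniteDimensional ℝ (TangentSpace 𝓘(ℝ, E) p) := inferInstanceAs (FiniteDimensional ℝ E)
  have : FiniteDimensional ℝ (TangentSpace 𝓘(ℝ, E') (proj p)) :=
    inferInstanceAs (FiniteDimensional ℝ E')
  have h1 : LinearMap.ker (mfderiv 𝓘(ℝ, E) 𝓘(ℝ, E') proj p).toLinearMap ≠ ⊥ :=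
    LinearMap.ker_ne_bot_of_finrank_lt h.finrank_lt
  exact Submodule.exists_mem_ne_zero_of_ne_bot h1

/-- The Clairaut equation at `v ± x`, separated by its degree in the horizontal vector `x`. The linear
part says that the fibres are totally umbilical with mean curvature vector field `-ℋ ∇f`. -/
theorem inner_covEndo_vertical_of_clairaut (h : IsRiemannianSubmersion E E' proj) {f : M → ℝ}
    {p : M}
    (hf : ∀ u : TangentSpace 𝓘(ℝ, E) p,
      mvfderiv 𝓘(ℝ, E) f p (hor E E' proj p u) * ‖vert E E' proj p u‖ ^ 2
        = - (1 / 2) * inner ℝ (covEndo h.isSmoothEndo_vert p u u) u)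
    {v x : TangentSpace 𝓘(ℝ, E) p} (hv : v ∈ verticalSpace E E' proj p)
    (hx : x ∈ horizontalSpace E E' proj p) :
    inner ℝ (covEndo h.isSmoothEndo_vert p v v) x = - mvfderiv 𝓘(ℝ, E) f p x * ‖v‖ ^ 2
      ∧ inner ℝ (covEndo h.isSmoothEndo_vert p v x) x = (0 : ℝ) := by
  have e (c : ℝ) := hf (v + c • x)
  simp only [h.inner_covEndo_self] at e
  simp only [map_add, map_smul, vert_eq_self hv, vert_eq_zero hx,
    hor_eq_self hx, hor_eq_zero hv, smul_zero, add_zero, zero_add, inner_add_left,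
    real_inner_smul_left, inner_smul_right, smul_eq_mul] at e
  have e1 := e 1
  have e2 := e (-1)
  constructor <;> linarith

/-- The part of the Clairaut equation quadratic in the horizontal component, polarised. -/
theorem inner_covEndo_horizontal_of_clairaut (h : IsRiemannianSubmersion E E' proj) {f : M → ℝ}
    {p : M}
    (hf : ∀ u : TangentSpace 𝓘(ℝ, E) p,
      mvfderiv 𝓘(ℝ, E) f p (hor E E' proj p u) * ‖vert E E' proj p u‖ ^ 2
        = - (1 / 2) * inner ℝ (covEndo h.isSmoothEndo_vert p u u) u)
    {v x y : TangentSpace 𝓘(ℝ, E) p} (hv : v ∈ verticalSpace E E' proj p)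
    (hx : x ∈ horizontalSpace E E' proj p) (hy : y ∈ horizontalSpace E E' proj p) :
    inner ℝ (covEndo h.isSmoothEndo_vert p v x) y
      = - (inner ℝ (covEndo h.isSmoothEndo_vert p v y) x : ℝ) := by
  have e1 := (inner_covEndo_vertical_of_clairaut h hf hv hx).2
  have e2 := (inner_covEndo_vertical_of_clairaut h hf hv hy).2
  have e3 := (inner_covEndo_vertical_of_clairaut h hf hv (add_mem hx hy)).2
  rw [map_add, inner_add_left, inner_add_right, inner_add_right] at e3
  linarith

/-- The derivative of the vertical projection, paired with the Reeb field. -/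
theorem inner_covEndo_vert_ξ (hS : IsSasakian φ ξ η) (h : IsRiemannianSubmersion E E' proj)
    (hξ : ∀ p, ξ p ∈ horizontalSpace E E' proj p) {p : M} (u : TangentSpace 𝓘(ℝ, E) p)
    {v : TangentSpace 𝓘(ℝ, E) p} (hv : v ∈ verticalSpace E E' proj p) :
    inner ℝ (covEndo h.isSmoothEndo_vert p v u) (ξ p) = (inner ℝ v (φ p u) : ℝ) := by
  have h1 := leviCivita_endo h.isSmoothEndo_vert (hS.isSmoothField.mdiffAt p) u
  have h2 : (fun x ↦ vert E E' proj x (ξ x)) = fun x ↦ (0 : TangentSpace 𝓘(ℝ, E) x) := by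
    ext x; exact vert_eq_zero (hξ x)
  have h3 : leviCivita E M (fun x ↦ (0 : TangentSpace 𝓘(ℝ, E) x)) p u = 0 :=
    congr($((leviCivita E M).zero) p u)
  rw [h2, h3, hS.leviCivita_ξ, map_neg, ← sub_eq_add_neg, eq_comm, sub_eq_zero] at h1
  rw [h.inner_covEndo_comm, h1, inner_vert_left, vert_eq_self hv, real_inner_comm]

section

variable (hS : IsSasakian φ ξ η) (h : IsAntiInvariantSubmersion E E' φ proj)
  (hξ : ∀ p, ξ p ∈ horizontalSpace E E' proj p) {f : M → ℝ}
  (hf : ∀ p (u : TangentSpace 𝓘(ℝ, E) p),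
    mvfderiv 𝓘(ℝ, E) f p (hor E E' proj p u) * ‖vert E E' proj p u‖ ^ 2
      = - (1 / 2) * inner ℝ (covEndo h.isSmoothEndo_vert p u u) u)

include hS h hξ hf

/-- The second fundamental form of the fibres satisfies `g(𝒯_v v, ξ) = g(v, φ v) = 0`, and the fibres
are totally umbilical with mean curvature vector field `-ℋ ∇f`. -/
theorem mvfderiv_ξ_of_clairaut (p : M) : mvfderiv 𝓘(ℝ, E) f p (ξ p) = 0 := by
  obtain ⟨v, hv, hv0⟩ := h.exists_vertical_ne_zero p
  have h1 := (inner_covEndo_vertical_of_clairaut h.1 (hf p) hv (hξ p)).1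
  rw [inner_covEndo_vert_ξ hS h.1 hξ v hv, inner_vertical_horizontal hv
    (h.anti_invariant p v hv)] at h1
  have h2 : ‖v‖ ^ 2 ≠ 0 := pow_ne_zero _ (norm_ne_zero_iff.mpr hv0)
  have := mul_eq_zero.mp h1.symm
  simpa [h2] using this

/-- `(∇_ξ 𝒱) v = φ v` for vertical `v`. -/
theorem covEndo_vert_ξ_of_clairaut {p : M} {v : TangentSpace 𝓘(ℝ, E) p}
    (hv : v ∈ verticalSpace E E' proj p) : covEndo h.isSmoothEndo_vert p v (ξ p) = φ p v := by
  refine ext_inner_right ℝ fun w ↦ ?_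
  have h1 := h.covEndo_vert_mem (ξ p) hv
  have h2 := h.anti_invariant p v hv
  rw [← vert_add_hor (E' := E') proj p w, inner_add_right, inner_add_right,
    inner_horizontal_vertical h1 (vert_mem proj p w),
    inner_horizontal_vertical h2 (vert_mem proj p w),
    inner_covEndo_horizontal_of_clairaut h.1 (hf p) hv (hξ p) (hor_mem proj p w),
    inner_covEndo_vert_ξ hS h.1 hξ _ hv, hS.inner_φ_left]

/-- The covariant derivative along `ξ` of a vertical field, up to a vertical remainder. -/
theorem leviCivita_vertical_ξ_of_clairaut {V : Π x : M, TangentSpace 𝓘(ℝ, E) x}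
    (hV : IsSmoothField V) (hVm : ∀ x, V x ∈ verticalSpace E E' proj x) (x : M) :
    leviCivita E M V x (ξ x) = φ x (V x) + vert E E' proj x (leviCivita E M V x (ξ x)) := by
  have h1 := leviCivita_endo h.isSmoothEndo_vert (hV.mdiffAt x) (ξ x)
  simp only [vert_eq_self (hVm _)] at h1
  rwa [covEndo_vert_ξ_of_clairaut hS h hξ hf (hVm x)] at h1

/-- If the Clairaut equation holds at all tangent vectors, the second fundamental form of the
fibres satisfies `g(𝒯_v v, φ v) = 0`. For a vertical field `V`, put `D = 𝒱 ∇_ξ V`; then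
`[V, ξ] = -2 φ V - D` and `[φ V, ξ] = 2 V - φ D`, and the claim is the Jacobi identity of `V`,
`φ V`, `ξ`, paired with `φ V`. -/
theorem inner_covEndo_φ_of_clairaut {p : M} {v : TangentSpace 𝓘(ℝ, E) p}
    (hv : v ∈ verticalSpace E E' proj p) :
    inner ℝ (covEndo h.isSmoothEndo_vert p v v) (φ p v) = (0 : ℝ) := by
  have : IsManifold 𝓘(ℝ, E) (minSmoothness ℝ 3) M := by
    rw [minSmoothness_of_isRCLikeNormedField]; infer_instance
  have hmin : (minSmoothness ℝ 2 : ℕ∞ω) ≤ ∞ := by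
    rw [minSmoothness_of_isRCLikeNormedField]; exact ENat.LEInfty.out
  have hφ := hS.isSmoothEndo
  have hP := h.isSmoothEndo_vert
  have hξs := hS.isSmoothField
  obtain ⟨V, hV, hVm, rfl⟩ : ∃ V : Π x : M, TangentSpace 𝓘(ℝ, E) x, IsSmoothField V ∧
      (∀ x, V x ∈ verticalSpace E E' proj x) ∧ V p = v := by
    obtain ⟨Y, hY, rfl⟩ := exists_smooth_extension v
    exact ⟨fun x ↦ vert E E' proj x (Y x), hP Y hY, fun x ↦ vert_mem proj x _, vert_eq_self hv⟩
  obtain ⟨D, hDdef⟩ : ∃ D : Π x : M, TangentSpace 𝓘(ℝ, E) x,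
    D = fun x ↦ vert E E' proj x (leviCivita E M V x (ξ x)) := ⟨_, rfl⟩
  have hD : IsSmoothField D := hDdef ▸ hP _ (hξs.leviCivita hV)
  have hDm (x) : D x ∈ verticalSpace E E' proj x := hDdef ▸ vert_mem proj x _
  have hφV := hφ _ hV
  have hφD := hφ _ hD
  have hφVm (x) : φ x (V x) ∈ horizontalSpace E E' proj x := h.anti_invariant x _ (hVm x)
  have hφDm (x) : φ x (D x) ∈ horizontalSpace E E' proj x := h.anti_invariant x _ (hDm x)
  have ηV (x) : η x (V x) = 0 := η_vertical hS hξ (hVm x)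
  have ηD (x) : η x (D x) = 0 := η_vertical hS hξ (hDm x)
  have ξφ (x) (w : TangentSpace 𝓘(ℝ, E) x) : inner ℝ (ξ x) (φ x w) = (0 : ℝ) := by
    rw [real_inner_comm (φ x w), hS.inner_φ_ξ]
  have hVξ (x) : leviCivita E M V x (ξ x) = φ x (V x) + D x :=
    hDdef ▸ leviCivita_vertical_ξ_of_clairaut hS h hξ hf hV hVm x
  -- derivatives of vertical fields and of their images under `φ`
  have cV {W : Π x : M, TangentSpace 𝓘(ℝ, E) x} (hW : IsSmoothField W)
      (hWm : ∀ x, W x ∈ verticalSpace E E' proj x) (x) (u b : TangentSpace 𝓘(ℝ, E) x)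
      (hb : b ∈ horizontalSpace E E' proj x) :
      inner ℝ (leviCivita E M W x u) b = (inner ℝ (covEndo hP x (W x) u) b : ℝ) := by
    have h1 := leviCivita_endo hP (hW.mdiffAt x) u
    simp only [vert_eq_self (hWm _)] at h1
    conv_lhs => rw [h1, inner_add_left, inner_vertical_horizontal (vert_mem proj x _) hb, add_zero]
  have cφ {W : Π x : M, TangentSpace 𝓘(ℝ, E) x} (hW : IsSmoothField W) (x)
      (u : TangentSpace 𝓘(ℝ, E) x) :
      leviCivita E M (fun x ↦ φ x (W x)) x u = (inner ℝ u (W x) : ℝ) • ξ x - η x (W x) • u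
        + φ x (leviCivita E M W x u) := by
    rw [leviCivita_endo hφ (hW.mdiffAt x), hS.covEndo_φ]
  have hφVξ (x) : leviCivita E M (fun x ↦ φ x (V x)) x (ξ x) = - V x + φ x (D x) := by
    rw [cφ hV, hVξ, map_add, hS.φ_φ, ηV, real_inner_comm, ← hS.η_eq_inner, ηV]
    simp
  -- the brackets with `ξ`
  have b1 : mlieBracket 𝓘(ℝ, E) ξ V = (fun x ↦ (2 : ℝ) • φ x (V x)) + D := by
    ext x
    rw [leviCivita_sub_swap (hξs.mdiffAt x) (hV.mdiffAt x), hVξ, hS.leviCivita_ξ, Pi.add_apply]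
    module
  have b2 : mlieBracket 𝓘(ℝ, E) ξ (fun x ↦ φ x (V x))
      = (fun x ↦ (-2 : ℝ) • V x) + fun x ↦ φ x (D x) := by
    ext x
    rw [leviCivita_sub_swap (hξs.mdiffAt x) (hφV.mdiffAt x), hφVξ, hS.leviCivita_ξ, hS.φ_φ, ηV,
      Pi.add_apply]
    module
  have jac := leibniz_identity_mlieBracket_apply ((hξs p).of_le hmin)
    ((hV p).of_le hmin) ((hφV p).of_le hmin)
  set Z := mlieBracket 𝓘(ℝ, E) V (fun x ↦ φ x (V x)) with hZdef
  have hZ : IsSmoothField Z := hV.mlieBracket hφV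
  have s1 : mlieBracket 𝓘(ℝ, E) (fun x ↦ (2 : ℝ) • φ x (V x)) (fun x ↦ φ x (V x)) p = 0 := by
    have := mlieBracket_const_smul_left (I := 𝓘(ℝ, E)) (c := (2 : ℝ))
      (W := fun x ↦ φ x (V x)) (hφV.mdiffAt p)
    rw [mlieBracket_self] at this
    exact this.trans (smul_zero _)
  have s2 : mlieBracket 𝓘(ℝ, E) V (fun x ↦ (-2 : ℝ) • V x) p = 0 := by
    have := mlieBracket_const_smul_right (I := 𝓘(ℝ, E)) (c := (-2 : ℝ))
      (V := V) (hV.mdiffAt p)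
    rw [mlieBracket_self] at this
    exact this.trans (smul_zero _)
  rw [b1, b2, mlieBracket_add_left ((hφV.const_smul 2).mdiffAt p) (hD.mdiffAt p),
    mlieBracket_add_right ((hV.const_smul (-2)).mdiffAt p) (hφD.mdiffAt p), s1, s2, zero_add,
    zero_add, leviCivita_sub_swap (hξs.mdiffAt p) (hZ.mdiffAt p),
    leviCivita_sub_swap (hD.mdiffAt p) (hφV.mdiffAt p),
    leviCivita_sub_swap (hV.mdiffAt p) (hφD.mdiffAt p), hS.leviCivita_ξ] at jac
  have hZx (x) : Z x = leviCivita E M (fun x ↦ φ x (V x)) x (V x)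
      - leviCivita E M V x (φ x (V x)) :=
    leviCivita_sub_swap (hV.mdiffAt x) (hφV.mdiffAt x)
  -- pair the Jacobi identity with `φ V`; the second derivatives of `n = ‖V‖²` that appear combine
  -- to a derivative along the bracket of `ξ` and `V`
  have sk {x} {a b c : TangentSpace 𝓘(ℝ, E) x} (ha : a ∈ verticalSpace E E' proj x)
      (hb : b ∈ horizontalSpace E E' proj x) (hc : c ∈ horizontalSpace E E' proj x) :=
    inner_covEndo_horizontal_of_clairaut h.1 (hf x) ha hb hc
  have sk0 {x} {a b : TangentSpace 𝓘(ℝ, E) x} (ha : a ∈ verticalSpace E E' proj x)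
      (hb : b ∈ horizontalSpace E E' proj x) :=
    (inner_covEndo_vertical_of_clairaut h.1 (hf x) ha hb).2
  let n : M → ℝ := fun x ↦ inner ℝ (V x) (V x)
  have hn : ContMDiff 𝓘(ℝ, E) 𝓘(ℝ, ℝ) ∞ n := hV.inner hV
  have dn (x) (u : TangentSpace 𝓘(ℝ, E) x) :
      mvfderiv 𝓘(ℝ, E) n x u = 2 * inner ℝ (leviCivita E M V x u) (V x) := by
    obtain ⟨U, hU, rfl⟩ := exists_smooth_extension u
    rw [leviCivita_inner (hU.mdiffAt x) (hV.mdiffAt x) (hV.mdiffAt x),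
      real_inner_comm _ (V x)]
    ring
  have z1 : (fun x ↦ (inner ℝ (Z x) (φ x (V x)) : ℝ))
      = fun x ↦ (1 / 2 : ℝ) • mvfderiv 𝓘(ℝ, E) n x (V x) := by
    ext x
    rw [hZx, inner_sub_left, cV hV hVm x _ _ (hφVm x), sk0 (hVm x) (hφVm x), cφ hV, ηV,
      inner_add_left, inner_sub_left, real_inner_smul_left, ξφ, hS.inner_φ_φ, ηV, zero_smul,
      inner_zero_left, dn, smul_eq_mul]
    ring
  have z2 : (fun x ↦ (inner ℝ (V x) (D x) : ℝ))
      = fun x ↦ (1 / 2 : ℝ) • mvfderiv 𝓘(ℝ, E) n x (ξ x) := by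
    ext x
    rw [dn, hVξ, inner_add_left, inner_horizontal_vertical (hφVm x) (hVm x), smul_eq_mul,
      real_inner_comm (V x)]
    ring
  have dsm {k : M → ℝ} (hk : ContMDiff 𝓘(ℝ, E) 𝓘(ℝ, ℝ) ∞ k) (u : TangentSpace 𝓘(ℝ, E) p) :
      mvfderiv 𝓘(ℝ, E) (fun x ↦ (1 / 2 : ℝ) • k x) p u = 1 / 2 * mvfderiv 𝓘(ℝ, E) k p u := by
    have h1 := mvfderiv_mul (I := 𝓘(ℝ, E)) (f := fun _ : M ↦ (1 / 2 : ℝ)) (g := k) (x := p)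
      mdifferentiableAt_const ((hk p).mdifferentiableAt (by simp))
    rw [mvfderiv_const, smul_zero, add_zero] at h1
    exact congr($h1 u)
  have p1 := leviCivita_inner (hξs.mdiffAt p) (hZ.mdiffAt p) (hφV.mdiffAt p)
  rw [z1, dsm (contMDiff_mvfderiv_apply hn hV), hφVξ, inner_add_right, inner_neg_right] at p1
  have p2 := leviCivita_inner (hV.mdiffAt p) (hV.mdiffAt p) (hD.mdiffAt p)
  rw [z2, dsm (contMDiff_mvfderiv_apply hn hξs)] at p2
  have p3 := mvfderiv_mlieBracket hn hξs hV p
  rw [b1, Pi.add_apply, map_add, map_smul, smul_eq_mul] at p3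
  have p4 : inner ℝ (Z p) (V p) = - inner ℝ (covEndo hP p (V p) (V p)) (φ p (V p))
      - 1 / 2 * mvfderiv 𝓘(ℝ, E) n p (φ p (V p)) := by
    rw [hZx, inner_sub_left, cφ hV, ηV, inner_add_left, inner_sub_left, real_inner_smul_left,
      inner_horizontal_vertical (hξ p) (hVm p), zero_smul, inner_zero_left, hS.inner_φ_left,
      cV hV hVm p _ _ (hφVm p), dn]
    ring
  have p5 : inner ℝ (Z p) (φ p (D p)) = inner ℝ (leviCivita E M V p (V p)) (D p)
      - inner ℝ (covEndo hP p (V p) (φ p (V p))) (φ p (D p)) := by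
    rw [hZx, inner_sub_left, cφ hV, ηV, inner_add_left, inner_sub_left, real_inner_smul_left,
      ξφ, zero_smul, inner_zero_left, hS.inner_φ_φ, ηD, cV hV hVm p _ _ (hφDm p)]
    ring
  have p6 := congr(inner ℝ $jac (φ p (V p)))
  rw [inner_add_left, inner_sub_left, inner_sub_left, inner_sub_left, inner_neg_left,
    hS.inner_φ_φ, ηV, cφ hV, cφ hD, cV hD hDm p _ _ (hφVm p), cV hV hVm p _ _ (hφVm p),
    sk0 (hDm p) (hφVm p), ηV, ηD, inner_add_left, inner_add_left, inner_sub_left, inner_sub_left,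
    real_inner_smul_left, real_inner_smul_left, ξφ, zero_smul, inner_zero_left] at p6
  simp only [real_inner_smul_left, ξφ, hS.inner_φ_φ, ηV] at p6
  have p7 := dn p (D p)
  have p8 := sk (hVm p) (hφVm p) (hφDm p)
  rw [real_inner_comm _ (V p)] at p2
  linarith

/-- If the Clairaut equation holds at all tangent vectors, then `f` is constant in vertical
directions: for every vertical field `V`, `df` annihilates `ξ` and `φ V`, hence their bracket
`[ξ, φ V]`, which is `-2 V` up to the image under `φ` of a vertical field. -/
theorem mvfderiv_vertical_of_clairaut (hfs : ContMDiff 𝓘(ℝ, E) 𝓘(ℝ, ℝ) ∞ f) {p : M}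
    {v : TangentSpace 𝓘(ℝ, E) p} (hv : v ∈ verticalSpace E E' proj p) :
    mvfderiv 𝓘(ℝ, E) f p v = 0 := by
  have hφ := hS.isSmoothEndo
  have hP := h.isSmoothEndo_vert
  have hξs := hS.isSmoothField
  have key (x) (w : TangentSpace 𝓘(ℝ, E) x) (hw : w ∈ verticalSpace E E' proj x) :
      mvfderiv 𝓘(ℝ, E) f x (φ x w) = 0 := by
    rcases eq_or_ne w 0 with rfl | hw0
    · simp
    have h1 := (inner_covEndo_vertical_of_clairaut h.1 (hf x) hw (h.anti_invariant x w hw)).1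
    rw [inner_covEndo_φ_of_clairaut hS h hξ hf hw] at h1
    have h2 : ‖w‖ ^ 2 ≠ 0 := pow_ne_zero _ (norm_ne_zero_iff.mpr hw0)
    have := mul_eq_zero.mp h1.symm
    simpa [h2] using this
  obtain ⟨V, hV, hVm, rfl⟩ : ∃ V : Π x : M, TangentSpace 𝓘(ℝ, E) x, IsSmoothField V ∧
      (∀ x, V x ∈ verticalSpace E E' proj x) ∧ V p = v := by
    obtain ⟨Y, hY, rfl⟩ := exists_smooth_extension v
    exact ⟨fun x ↦ vert E E' proj x (Y x), hP Y hY, fun x ↦ vert_mem proj x _, vert_eq_self hv⟩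
  have h1 := mvfderiv_mlieBracket hfs hξs (hφ _ hV) p
  simp only [key _ _ (hVm _), mvfderiv_ξ_of_clairaut hS h hξ hf, mvfderiv_const,
    _root_.zero_apply, sub_zero] at h1
  rw [leviCivita_sub_swap (hξs.mdiffAt p) ((hφ _ hV).mdiffAt p),
    leviCivita_endo hφ (hV.mdiffAt p), hS.covEndo_φ, η_vertical hS hξ (hVm p),
    leviCivita_vertical_ξ_of_clairaut hS h hξ hf hV hVm p, hS.leviCivita_ξ] at h1
  simp only [map_sub, map_add, map_neg, map_smul, hS.φ_φ, η_vertical hS hξ (hVm p),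
    key _ _ (vert_mem proj p _), mvfderiv_ξ_of_clairaut hS h hξ hf, smul_zero, zero_smul,
    map_zero] at h1
  linarith

end

end Rigidity

/-! ### Covariant derivatives along curves -/

section AlongCurves

open Filter Topology

variable {E : Type*} [NormedAddCommGroup E] [NormedSpace ℝ E] [FiniteDimensional ℝ E]
  {M : Type*} [TopologicalSpace M] [ChartedSpace E M] [IsManifold 𝓘(ℝ, E) ∞ M]

/-- Coordinates of a combination of frame vectors. -/
theorem eventually_trivializationAt_sum_frame {p : M}
    {F : Fin (Module.finrank ℝ E) → Π x : M, TangentSpace 𝓘(ℝ, E) x}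
    (hF : ∀ᶠ x in 𝓝 p, ∀ i, F i x =
        (trivializationAt E (TangentSpace 𝓘(ℝ, E) : M → Type _) p).symm x
          (Module.finBasis ℝ E i)) :
    ∀ᶠ x in 𝓝 p, ∀ c : Fin (Module.finrank ℝ E) → ℝ,
      (trivializationAt E (TangentSpace 𝓘(ℝ, E) : M → Type _) p ⟨x, ∑ i, c i • F i x⟩).2
        = ∑ i, c i • Module.finBasis ℝ E i := by
  set e := trivializationAt E (TangentSpace 𝓘(ℝ, E) : M → Type _) p
  have h2 : ∀ᶠ x in 𝓝 p, x ∈ e.baseSet := e.open_baseSet.mem_nhds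
      (FiberBundle.mem_baseSet_trivializationAt' p)
  filter_upwards [hF, h2] with x hx hx2 c
  simp_rw [hx]
  have h3 : ∀ w : E, e.symm x w = e.symmL ℝ x w := fun w ↦ (e.symmL_apply (hb := hx2) ..).symm
  simp_rw [h3, ← map_smul, ← map_sum]
  rw [← h3, e.apply_mk_symm hx2]

/-- The coordinates of the velocity in the trivialization by a chart are the derivatives of the
coordinates of the curve. -/
theorem trivializationAt_velocity {α : ℝ → M} {p : M} {s : ℝ}
    (hα : MDifferentiableAt 𝓘(ℝ, ℝ) 𝓘(ℝ, E) α s) (hs : α s ∈ (chartAt E p).source) :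
    (trivializationAt E (TangentSpace 𝓘(ℝ, E) : M → Type _) p ⟨α s, velocity E α s⟩).2
      = deriv (fun s ↦ extChartAt 𝓘(ℝ, E) p (α s)) s := by
  have h1 : HasMFDerivAt 𝓘(ℝ, ℝ) 𝓘(ℝ, E) (fun s ↦ extChartAt 𝓘(ℝ, E) p (α s)) s
      ((mfderiv 𝓘(ℝ, E) 𝓘(ℝ, E) (extChartAt 𝓘(ℝ, E) p) (α s)).comp
        (mfderiv 𝓘(ℝ, ℝ) 𝓘(ℝ, E) α s)) :=
    HasMFDerivAt.comp s (mdifferentiableAt_extChartAt hs).hasMFDerivAt hα.hasMFDerivAt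
  obtain ⟨D, hD, hD1⟩ : ∃ D : ℝ →L[ℝ] E,
      HasFDerivAt (fun s ↦ extChartAt 𝓘(ℝ, E) p (α s)) D s ∧
      D 1 = mfderiv 𝓘(ℝ, E) 𝓘(ℝ, E) (extChartAt 𝓘(ℝ, E) p) (α s) (velocity E α s) :=
    ⟨_, hasMFDerivAt_iff_hasFDerivAt.mp h1, rfl⟩
  rw [hD.hasDerivAt.deriv, hD1, ← TangentBundle.continuousLinearMapAt_trivializationAt hs]
  have hs' : α s ∈ (trivializationAt E (TangentSpace 𝓘(ℝ, E) : M → Type _) p).baseSet := by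
    simpa using hs
  exact congrFun (Bundle.Trivialization.coe_linearMapAt_of_mem (R := ℝ) _ hs').symm
    (velocity E α s)

/-- The coordinates of the velocity of a `C^2` curve are differentiable. -/
theorem differentiableAt_trivializationAt_velocity {α : ℝ → M} {J : Set ℝ} (hJ : IsOpen J)
    (hα : ContMDiffOn 𝓘(ℝ, ℝ) 𝓘(ℝ, E) 2 α J) {t : ℝ} (ht : t ∈ J) :
    DifferentiableAt ℝ (fun s ↦ (trivializationAt E (TangentSpace 𝓘(ℝ, E) : M → Type _) (α t)
      ⟨α s, velocity E α s⟩).2) t := by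
  have hα' := hα.contMDiffAt (hJ.mem_nhds ht)
  have h1 : ContDiffAt ℝ 2 (fun s ↦ extChartAt 𝓘(ℝ, E) (α t) (α s)) t :=
    (ContMDiffAt.comp t (contMDiffAt_extChartAt (n := 2)) hα').contDiffAt
  have h2 : DifferentiableAt ℝ (deriv (fun s ↦ extChartAt 𝓘(ℝ, E) (α t) (α s))) t :=
    (h1.derivWithin (m := 1) (by norm_num)).differentiableAt (by simp)
  refine h2.congr_of_eventuallyEq ?_
  have h3 : ∀ᶠ s in 𝓝 t, α s ∈ (chartAt E (α t)).source :=
    hα'.continuousAt ((chartAt E (α t)).open_source.mem_nhds (mem_chart_source E (α t)))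
  filter_upwards [h3, hJ.mem_nhds ht] with s hs hs'
  exact trivializationAt_velocity
    ((hα.contMDiffAt (hJ.mem_nhds hs')).mdifferentiableAt (by simp)) hs

variable [RiemannianBundle (fun x : M ↦ TangentSpace 𝓘(ℝ, E) x)]
  [IsContMDiffRiemannianBundle 𝓘(ℝ, E) ∞ E (fun x : M ↦ TangentSpace 𝓘(ℝ, E) x)]

/-- The covariant derivative along a curve in terms of a frame. -/
theorem covDerivAlong_sum_frame {α : ℝ → M} {t : ℝ} (hα : ContinuousAt α t)
    {F : Fin (Module.finrank ℝ E) → Π x : M, TangentSpace 𝓘(ℝ, E) x}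
    (hF : ∀ i, IsSmoothField (F i))
    (hF' : ∀ᶠ x in 𝓝 (α t), ∀ i, F i x =
        (trivializationAt E (TangentSpace 𝓘(ℝ, E) : M → Type _) (α t)).symm x
          (Module.finBasis ℝ E i))
    {W : Π s : ℝ, TangentSpace 𝓘(ℝ, E) (α s)} {w : Fin (Module.finrank ℝ E) → ℝ → ℝ}
    (hw : ∀ i, DifferentiableAt ℝ (w i) t) (hW : ∀ᶠ s in 𝓝 t, W s = ∑ i, w i s • F i (α s)) :
    covDerivAlong α W t = ∑ i, (deriv (w i) t • F i (α t)
      + w i t • leviCivita E M (F i) (α t) (velocity E α t)) := by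
  set e := trivializationAt E (TangentSpace 𝓘(ℝ, E) : M → Type _) (α t)
  have he : α t ∈ e.baseSet := FiberBundle.mem_baseSet_trivializationAt' (α t)
  have h3 : ∀ w : E, e.symm (α t) w = e.symmL ℝ (α t) w :=
    fun w ↦ (e.symmL_apply (hb := he) ..).symm
  have h1 : (fun s ↦ (e ⟨α s, W s⟩).2) =ᶠ[𝓝 t] fun s ↦ ∑ i, w i s • Module.finBasis ℝ E i := by
    filter_upwards [hW, hα.eventually (eventually_trivializationAt_sum_frame hF')] with s hs hs'
    rw [hs, hs']
  have h2 : deriv (fun s ↦ (e ⟨α s, W s⟩).2) t = ∑ i, deriv (w i) t • Module.finBasis ℝ E i := by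
    rw [h1.deriv_eq, deriv_fun_sum fun i _ ↦ (hw i).smul_const _]
    exact Finset.sum_congr rfl fun i _ ↦ deriv_smul_const (hw i) _
  -- `extend` has constant coordinates in the trivialization
  have h4 : ∀ᶠ x in 𝓝 (α t), extend E (W t) x = ∑ i, w i t • F i x := by
    have he' : ∀ᶠ x in 𝓝 (α t), x ∈ e.baseSet := e.open_baseSet.mem_nhds he
    filter_upwards [hF', he'] with x hx hx'
    change e.symm x (e ⟨α t, W t⟩).2 = _
    have h3' : ∀ w : E, e.symm x w = e.symmL ℝ x w := fun w ↦ (e.symmL_apply (hb := hx') ..).symm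
    have h5 : (e ⟨α t, W t⟩).2 = _ := h1.self_of_nhds
    rw [h5, h3', map_sum]
    exact Finset.sum_congr rfl fun i _ ↦ by rw [map_smul, hx, h3']
  rw [covDerivAlong, h2, leviCivita_congr (mdifferentiableAt_extend _ _ _) h4,
    leviCivita_sum (fun i ↦ ((hF i).const_smul _).mdiffAt _), Finset.sum_add_distrib]
  congr 1
  · change e.symm (α t) _ = _
    rw [h3, map_sum]
    exact Finset.sum_congr rfl fun i _ ↦ by rw [map_smul, hF'.self_of_nhds, h3]
  · exact Finset.sum_congr rfl fun i _ ↦ leviCivita_const_smul _ ((hF i).mdiffAt _) _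

end AlongCurves

/-! ### Fields along geodesics -/

section Geodesics

open Filter Topology

variable {E : Type*} [NormedAddCommGroup E] [NormedSpace ℝ E] [FiniteDimensional ℝ E]
  {M : Type*} [TopologicalSpace M] [ChartedSpace E M] [IsManifold 𝓘(ℝ, E) ∞ M]

theorem hasDerivAt_comp_curve {h : M → ℝ} {α : ℝ → M} {t : ℝ} (hh : MDiffAt h (α t))
    (hα : MDifferentiableAt 𝓘(ℝ, ℝ) 𝓘(ℝ, E) α t) :
    HasDerivAt (fun s ↦ h (α s)) (mvfderiv 𝓘(ℝ, E) h (α t) (velocity E α t)) t := by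
  have h1 := HasMFDerivAt.comp t hh.hasMFDerivAt hα.hasMFDerivAt
  obtain ⟨D, hD, hD1⟩ : ∃ D : ℝ →L[ℝ] ℝ, HasFDerivAt (fun s ↦ h (α s)) D t ∧
      D 1 = mvfderiv 𝓘(ℝ, E) h (α t) (velocity E α t) :=
    ⟨_, hasMFDerivAt_iff_hasFDerivAt.mp h1, rfl⟩
  exact hD1 ▸ hD.hasDerivAt

variable [RiemannianBundle (fun x : M ↦ TangentSpace 𝓘(ℝ, E) x)]
  [IsContMDiffRiemannianBundle 𝓘(ℝ, E) ∞ E (fun x : M ↦ TangentSpace 𝓘(ℝ, E) x)]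

/-- Metric compatibility along a curve, for combinations of vector fields on `M` with coefficients
depending on the parameter. -/
theorem hasDerivAt_inner_sum {ι κ : Type*} [Fintype ι] [Fintype κ] {α : ℝ → M} {t : ℝ}
    (hα : MDifferentiableAt 𝓘(ℝ, ℝ) 𝓘(ℝ, E) α t)
    {G : ι → Π x : M, TangentSpace 𝓘(ℝ, E) x} (hG : ∀ i, MDiffAt (T% (G i)) (α t))
    {H : κ → Π x : M, TangentSpace 𝓘(ℝ, E) x} (hH : ∀ i, MDiffAt (T% (H i)) (α t))
    {a : ι → ℝ → ℝ} (ha : ∀ i, DifferentiableAt ℝ (a i) t)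
    {b : κ → ℝ → ℝ} (hb : ∀ i, DifferentiableAt ℝ (b i) t) :
    HasDerivAt (fun s ↦ (inner ℝ (∑ i, a i s • G i (α s)) (∑ k, b k s • H k (α s)) : ℝ))
      (inner ℝ (∑ i, (deriv (a i) t • G i (α t)
          + a i t • leviCivita E M (G i) (α t) (velocity E α t))) (∑ k, b k t • H k (α t))
        + inner ℝ (∑ i, a i t • G i (α t)) (∑ k, (deriv (b k) t • H k (α t)
          + b k t • leviCivita E M (H k) (α t) (velocity E α t)))) t := by
  have bil {s : ℝ} (x : ι → TangentSpace 𝓘(ℝ, E) (α s)) (y : κ → TangentSpace 𝓘(ℝ, E) (α s)) :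
      (inner ℝ (∑ i, x i) (∑ k, y k) : ℝ) = ∑ i, ∑ k, inner ℝ (x i) (y k) := by
    simp_rw [sum_inner, inner_sum]
  have key (i k) : HasDerivAt (fun s ↦ a i s * b k s * (inner ℝ (G i (α s)) (H k (α s)) : ℝ)) _ t :=
    ((ha i).hasDerivAt.mul (hb k).hasDerivAt).mul
      (hasDerivAt_comp_curve (mdifferentiableAt_inner (hG i) (hH k)) hα)
  have h1 := HasDerivAt.fun_sum (u := Finset.univ) fun i _ ↦
    HasDerivAt.fun_sum (u := Finset.univ) fun k _ ↦ key i k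
  have hU := mdifferentiableAt_extend 𝓘(ℝ, E) E (velocity E α t)
  refine (h1.congr_of_eventuallyEq (.of_forall fun s ↦ ?_)).congr_deriv (Eq.symm ?_)
  · simp_rw [bil, real_inner_smul_left, real_inner_smul_right, mul_assoc]
  · rw [bil, bil, ← Finset.sum_add_distrib]
    refine Finset.sum_congr rfl fun i _ ↦ ?_
    rw [← Finset.sum_add_distrib]
    refine Finset.sum_congr rfl fun k _ ↦ ?_
    have h2 := leviCivita_inner hU (hG i) (hH k)
    rw [extend_apply_self] at h2
    rw [h2]
    simp only [inner_add_left, inner_add_right, real_inner_smul_left, real_inner_smul_right,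
      Pi.mul_apply]
    ring

variable [T2Space M]

/-- The covariant derivative along a curve of a combination of vector fields on `M` with
coefficients depending on the parameter. -/
theorem covDerivAlong_sum {ι : Type*} [Fintype ι] {α : ℝ → M} {t : ℝ}
    (hα : MDifferentiableAt 𝓘(ℝ, ℝ) 𝓘(ℝ, E) α t)
    {G : ι → Π x : M, TangentSpace 𝓘(ℝ, E) x} (hG : ∀ k, MDiffAt (T% (G k)) (α t))
    {w : ι → ℝ → ℝ} (hw : ∀ k, DifferentiableAt ℝ (w k) t)
    {W : Π s : ℝ, TangentSpace 𝓘(ℝ, E) (α s)}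
    (hW : ∀ᶠ s in 𝓝 t, W s = ∑ k, w k s • G k (α s)) :
    covDerivAlong α W t = ∑ k, (deriv (w k) t • G k (α t)
      + w k t • leviCivita E M (G k) (α t) (velocity E α t)) := by
  obtain ⟨F, hF, hF'⟩ := exists_smooth_frame (E := E) (α t)
  have hexp := eventually_eq_sum_frame hF'
  let g : ι → Fin (Module.finrank ℝ E) → M → ℝ := fun k i x ↦ (Module.finBasis ℝ E).repr
    ((trivializationAt E (TangentSpace 𝓘(ℝ, E) : M → Type _) (α t)) ⟨x, G k x⟩).2 i
  have hg (k i) : MDiffAt (g k i) (α t) := mdiffAt_repr (hG k) i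
  have hGF (k) : ∀ᶠ x in 𝓝 (α t), G k x = ∑ i, g k i x • F i x := by
    filter_upwards [hexp] with x hx using hx _
  have hd (i) : HasDerivAt (fun s ↦ ∑ k, w k s * g k i (α s)) _ t :=
    HasDerivAt.fun_sum fun k _ ↦ (hw k).hasDerivAt.mul (hasDerivAt_comp_curve (hg k i) hα)
  have hWF : ∀ᶠ s in 𝓝 t, W s = ∑ i, (∑ k, w k s * g k i (α s)) • F i (α s) := by
    filter_upwards [hW, hα.continuousAt.eventually hexp] with s hs hs'
    rw [hs]
    simp_rw [Finset.sum_smul]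
    rw [Finset.sum_comm]
    refine Finset.sum_congr rfl fun k _ ↦ ?_
    simp_rw [mul_smul]
    rw [← Finset.smul_sum, ← hs' (G k (α s))]
  rw [covDerivAlong_sum_frame hα.continuousAt hF hF' (fun i ↦ (hd i).differentiableAt) hWF]
  have hGn (k) : leviCivita E M (G k) (α t) (velocity E α t)
      = ∑ i, (g k i (α t) • leviCivita E M (F i) (α t) (velocity E α t)
        + mvfderiv 𝓘(ℝ, E) (g k i) (α t) (velocity E α t) • F i (α t)) := by
    rw [leviCivita_congr (hG k) (hGF k),
      leviCivita_sum (Y := fun i x ↦ g k i x • F i x) fun i ↦ (hg k i).smul_section ((hF i).mdiffAt _)]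
    exact Finset.sum_congr rfl fun i _ ↦ leviCivita_smul (hg k i) ((hF i).mdiffAt _) _
  simp_rw [hGn, fun k ↦ (hGF k).self_of_nhds, (hd _).deriv, Finset.sum_smul, Finset.smul_sum,
    ← Finset.sum_add_distrib]
  rw [Finset.sum_comm]
  refine Finset.sum_congr rfl fun k _ ↦ Finset.sum_congr rfl fun i _ ↦ ?_
  module

/-- Near each parameter, the velocity of a geodesic is a combination of smooth vector fields on `M`
with differentiable coefficients, and the geodesic equation is an equation for these. -/
theorem IsGeodesicOn.exists_frame {α : ℝ → M} {J : Set ℝ} (h : IsGeodesicOn E α J) {t : ℝ}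
    (ht : t ∈ J) :
    ∃ (F : Fin (Module.finrank ℝ E) → Π x : M, TangentSpace 𝓘(ℝ, E) x)
      (w : Fin (Module.finrank ℝ E) → ℝ → ℝ), (∀ i, IsSmoothField (F i)) ∧
      (∀ i, DifferentiableAt ℝ (w i) t) ∧
      (∀ᶠ s in 𝓝 t, velocity E α s = ∑ i, w i s • F i (α s)) ∧
      ∑ i, (deriv (w i) t • F i (α t)
        + w i t • leviCivita E M (F i) (α t) (velocity E α t)) = 0 := by
  obtain ⟨F, hF, hF'⟩ := exists_smooth_frame (E := E) (α t)
  have hα := (h.contMDiffOn.contMDiffAt (h.isOpen.mem_nhds ht)).mdifferentiableAt (by simp)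
  have hexp := eventually_eq_sum_frame hF'
  let w : Fin (Module.finrank ℝ E) → ℝ → ℝ := fun i s ↦ (Module.finBasis ℝ E).repr
    ((trivializationAt E (TangentSpace 𝓘(ℝ, E) : M → Type _) (α t)) ⟨α s, velocity E α s⟩).2 i
  have hw (i) : DifferentiableAt ℝ (w i) t :=
    (LinearMap.toContinuousLinearMap ((Module.finBasis ℝ E).coord i)).differentiableAt.comp t
      (differentiableAt_trivializationAt_velocity h.isOpen h.contMDiffOn ht)
  have hv : ∀ᶠ s in 𝓝 t, velocity E α s = ∑ i, w i s • F i (α s) := by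
    filter_upwards [hα.continuousAt.eventually hexp] with s hs using hs _
  refine ⟨F, w, hF, hw, hv, ?_⟩
  rw [← covDerivAlong_sum_frame hα.continuousAt hF hF' hw hv]
  exact h.covDeriv_velocity t ht

variable {α : ℝ → M} {J : Set ℝ}

theorem IsGeodesicOn.mdifferentiableAt (h : IsGeodesicOn E α J) {t : ℝ} (ht : t ∈ J) :
    MDifferentiableAt 𝓘(ℝ, ℝ) 𝓘(ℝ, E) α t :=
  (h.contMDiffOn.contMDiffAt (h.isOpen.mem_nhds ht)).mdifferentiableAt (by simp)

/-- Along a geodesic, `∇_α̇ (L α̇) = (∇_α̇ L) α̇`. -/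
theorem IsGeodesicOn.covDerivAlong_endo (h : IsGeodesicOn E α J) {t : ℝ} (ht : t ∈ J)
    {L : Π x : M, TangentSpace 𝓘(ℝ, E) x →L[ℝ] TangentSpace 𝓘(ℝ, E) x} (hL : IsSmoothEndo L) :
    covDerivAlong α (fun s ↦ L (α s) (velocity E α s)) t
      = covEndo hL (α t) (velocity E α t) (velocity E α t) := by
  obtain ⟨F, w, hF, hw, hv, h0⟩ := h.exists_frame ht
  have hLv : ∀ᶠ s in 𝓝 t, L (α s) (velocity E α s) = ∑ i, w i s • L (α s) (F i (α s)) := by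
    filter_upwards [hv] with s hs
    rw [hs, map_sum]
    simp_rw [map_smul]
  rw [covDerivAlong_sum (h.mdifferentiableAt ht) (fun i ↦ (hL _ (hF i)).mdiffAt _) hw hLv]
  have h1 := congr(L (α t) $h0)
  simp_rw [fun i ↦ leviCivita_endo hL ((hF i).mdiffAt (α t)) (velocity E α t)]
  simp only [map_sum, map_add, map_smul, map_zero, Finset.sum_add_distrib, smul_add] at h1 ⊢
  rw [add_left_comm, h1, add_zero]
  conv_rhs => enter [1, 2]; rw [hv.self_of_nhds]
  rw [map_sum, _root_.sum_apply]
  simp_rw [map_smul, _root_.smul_apply]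

/-- Along a geodesic, `g(L α̇, α̇)` has derivative `g((∇_α̇ L) α̇, α̇)`. -/
theorem IsGeodesicOn.hasDerivAt_inner_endo (h : IsGeodesicOn E α J) {t : ℝ} (ht : t ∈ J)
    {L : Π x : M, TangentSpace 𝓘(ℝ, E) x →L[ℝ] TangentSpace 𝓘(ℝ, E) x} (hL : IsSmoothEndo L) :
    HasDerivAt (fun s ↦ (inner ℝ (L (α s) (velocity E α s)) (velocity E α s) : ℝ))
      (inner ℝ (covEndo hL (α t) (velocity E α t) (velocity E α t)) (velocity E α t)) t := by
  obtain ⟨F, w, hF, hw, hv, h0⟩ := h.exists_frame ht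
  have hLv : ∀ᶠ s in 𝓝 t, L (α s) (velocity E α s) = ∑ i, w i s • L (α s) (F i (α s)) := by
    filter_upwards [hv] with s hs
    rw [hs, map_sum]
    simp_rw [map_smul]
  have hα := h.mdifferentiableAt ht
  have h1 := hasDerivAt_inner_sum hα (fun i ↦ (hL _ (hF i)).mdiffAt _)
    (fun i ↦ (hF i).mdiffAt _) hw hw
  rw [h0, inner_zero_right, add_zero, ← hv.self_of_nhds,
    ← covDerivAlong_sum hα (fun i ↦ (hL _ (hF i)).mdiffAt _) hw hLv,
    h.covDerivAlong_endo ht hL] at h1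
  refine h1.congr_of_eventuallyEq ?_
  filter_upwards [hv, hLv] with s hs hs'
  rw [← hs, ← hs']

/-- Geodesics have constant speed. -/
theorem IsGeodesicOn.hasDerivAt_norm_sq (h : IsGeodesicOn E α J) {t : ℝ} (ht : t ∈ J) :
    HasDerivAt (fun s ↦ (inner ℝ (velocity E α s) (velocity E α s) : ℝ)) 0 t := by
  obtain ⟨F, w, hF, hw, hv, h0⟩ := h.exists_frame ht
  have h1 := hasDerivAt_inner_sum (h.mdifferentiableAt ht) (fun i ↦ (hF i).mdiffAt _)
    (fun i ↦ (hF i).mdiffAt _) hw hw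
  rw [h0, inner_zero_right, inner_zero_left, add_zero] at h1
  refine h1.congr_of_eventuallyEq ?_
  filter_upwards [hv] with s hs
  rw [← hs]

end Geodesics

/-! ### Existence of geodesics -/

section GeodesicExistence

open Filter Topology

/-- A curve satisfying an autonomous equation with continuous right-hand side is of class `C^1`. -/
theorem contDiffOn_one_of_hasDerivAt {F : Type*} [NormedAddCommGroup F] [NormedSpace ℝ F]
    {Φ : F → F} {β : ℝ → F} {J : Set ℝ} (hJ : IsOpen J)
    (hβ : ∀ t ∈ J, HasDerivAt β (Φ (β t)) t) (hΦ : ∀ t ∈ J, ContinuousAt Φ (β t)) :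
    ContDiffOn ℝ 1 β J := by
  rw [show (1 : ℕ∞ω) = 0 + 1 by norm_num, contDiffOn_succ_iff_deriv_of_isOpen hJ]
  refine ⟨fun t ht ↦ (hβ t ht).differentiableAt.differentiableWithinAt, by simp, ?_⟩
  rw [contDiffOn_zero]
  refine ContinuousOn.congr (f := fun t ↦ Φ (β t)) (fun t ht ↦ ?_) fun t ht ↦ (hβ t ht).deriv
  exact ((hΦ t ht).comp (hβ t ht).continuousAt).continuousWithinAt

variable {E : Type*} [NormedAddCommGroup E] [NormedSpace ℝ E] [FiniteDimensional ℝ E]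
  {M : Type*} [TopologicalSpace M] [ChartedSpace E M] [IsManifold 𝓘(ℝ, E) ∞ M] [T2Space M]
  [RiemannianBundle (fun x : M ↦ TangentSpace 𝓘(ℝ, E) x)]
  [IsContMDiffRiemannianBundle 𝓘(ℝ, E) ∞ E (fun x : M ↦ TangentSpace 𝓘(ℝ, E) x)]

theorem contDiffAt_trivializationAt_symm {p : M} {Z : Π x : M, TangentSpace 𝓘(ℝ, E) x}
    (hZ : IsSmoothField Z) :
    ContDiffAt ℝ 1 (fun y ↦ (trivializationAt E (TangentSpace 𝓘(ℝ, E) : M → Type _) p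
      ⟨(extChartAt 𝓘(ℝ, E) p).symm y, Z ((extChartAt 𝓘(ℝ, E) p).symm y)⟩).2)
      (extChartAt 𝓘(ℝ, E) p p) := by
  have h1 := hZ p
  rw [contMDiffAt_totalSpace] at h1
  have h2 : ContMDiffAt 𝓘(ℝ, E) 𝓘(ℝ, E) ∞ (extChartAt 𝓘(ℝ, E) p).symm
      (extChartAt 𝓘(ℝ, E) p p) :=
    (contMDiffOn_extChartAt_symm p).contMDiffAt (extChartAt_target_mem_nhds p)
  have h4 := ContMDiffAt.comp_of_eq (x := extChartAt 𝓘(ℝ, E) p p) h1.2 h2 (extChartAt_to_inv p)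
  exact h4.contDiffAt.of_le (by simp)

/-- Every tangent vector is the initial velocity of a geodesic. -/
theorem exists_geodesic (p : M) (u : TangentSpace 𝓘(ℝ, E) p) :
    ∃ (α : ℝ → M) (J : Set ℝ), IsGeodesicOn E α J ∧ (0 : ℝ) ∈ J ∧
      (⟨α 0, velocity E α 0⟩ : TotalSpace E (TangentSpace 𝓘(ℝ, E) : M → Type _)) = ⟨p, u⟩ := by
  obtain ⟨F, hF, hF'⟩ := exists_smooth_frame (E := E) p
  have hexp := eventually_eq_sum_frame hF'
  set e := trivializationAt E (TangentSpace 𝓘(ℝ, E) : M → Type _) p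
  set ψ := extChartAt 𝓘(ℝ, E) p
  set b := Module.finBasis ℝ E
  let Γ : Fin (Module.finrank ℝ E) → Fin (Module.finrank ℝ E) → Π x : M, TangentSpace 𝓘(ℝ, E) x :=
    fun i j x ↦ leviCivita E M (F j) x (F i x)
  have hΓ (i j) : IsSmoothField (Γ i j) := (hF i).leviCivita (hF j)
  let γ : Fin (Module.finrank ℝ E) → Fin (Module.finrank ℝ E) → E → E :=
    fun i j y ↦ (e ⟨ψ.symm y, Γ i j (ψ.symm y)⟩).2
  let c (i) : E →L[ℝ] ℝ := LinearMap.toContinuousLinearMap (b.coord i)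
  -- the geodesic equation in the chart
  let Φ : E × E → E × E := fun z ↦ (z.2, - ∑ i, ∑ j, (c i z.2 * c j z.2) • γ i j z.1)
  set z₀ : E × E := (ψ p, (e ⟨p, u⟩).2)
  have hΦ : ContDiffAt ℝ 1 Φ z₀ := by
    refine contDiffAt_snd.prodMk (ContDiffAt.neg (ContDiffAt.sum fun i _ ↦ ContDiffAt.sum
      fun j _ ↦ ContDiffAt.smul ?_ ?_))
    · exact ((c i).contDiff.contDiffAt.comp z₀ contDiffAt_snd).mul
        ((c j).contDiff.contDiffAt.comp z₀ contDiffAt_snd)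
    · exact ContDiffAt.comp (g := γ i j) (f := Prod.fst) z₀
        (contDiffAt_trivializationAt_symm (hΓ i j)) contDiffAt_fst
  obtain ⟨β, hβ0, ε, hε, hβ⟩ :=
    hΦ.exists_forall_mem_closedBall_exists_eq_forall_mem_Ioo_hasDerivAt₀ 0
  simp only [zero_sub, zero_add] at hβ
  -- a neighbourhood on which the frame and the chart are available
  have hgood : ∀ᶠ z in 𝓝 z₀, ContinuousAt Φ z ∧ z.1 ∈ ψ.target ∧
      ψ.symm z.1 ∈ (chartAt E p).source ∧
      ∀ w : TangentSpace 𝓘(ℝ, E) (ψ.symm z.1),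
        w = ∑ i, b.repr (e ⟨ψ.symm z.1, w⟩).2 i • F i (ψ.symm z.1) := by
    have h1 : ∀ᶠ z in 𝓝 z₀, ContinuousAt Φ z :=
      (hΦ.eventually (by simp)).mono fun z hz ↦ hz.continuousAt
    have h2 : ∀ᶠ z in 𝓝 z₀, z.1 ∈ ψ.target :=
      (continuousAt_fst (p := z₀)).preimage_mem_nhds
        (extChartAt_target_mem_nhds (I := 𝓘(ℝ, E)) p)
    have h3 : Tendsto (fun z : E × E ↦ ψ.symm z.1) (𝓝 z₀) (𝓝 p) := by
      have := (continuousAt_extChartAt_symm (I := 𝓘(ℝ, E)) p).tendsto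
      rw [extChartAt_to_inv] at this
      exact this.comp continuousAt_fst
    filter_upwards [h1, h2, h3.eventually hexp,
      h3.eventually ((chartAt E p).open_source.mem_nhds (mem_chart_source E p))] with z a1 a2 a3 a4
    exact ⟨a1, a2, a4, a3⟩
  have hβc : ContinuousAt β 0 := (hβ 0 (by simp [hε])).continuousAt
  rw [← hβ0] at hgood
  obtain ⟨δ, hδ, hball⟩ := Metric.eventually_nhds_iff_ball.mp (hβc.eventually hgood)
  set J : Set ℝ := Set.Ioo (-(min ε δ)) (min ε δ) with hJdef
  have hJ : IsOpen J := isOpen_Ioo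
  have hJβ (t) (ht : t ∈ J) : HasDerivAt β (Φ (β t)) t :=
    hβ t ⟨by linarith [ht.1, min_le_left ε δ], by linarith [ht.2, min_le_left ε δ]⟩
  have hJg (t) (ht : t ∈ J) := hball t (by
    rw [Metric.mem_ball, Real.dist_eq, sub_zero, abs_lt]
    exact ⟨by linarith [ht.1, min_le_right ε δ], by linarith [ht.2, min_le_right ε δ]⟩)
  have h0J : (0 : ℝ) ∈ J := by simp [hJdef, hε, hδ]
  have hβ1 : ContDiffOn ℝ 1 β J := contDiffOn_one_of_hasDerivAt hJ hJβ fun t ht ↦ (hJg t ht).1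
  have hx (t) (ht : t ∈ J) : HasDerivAt (fun s ↦ (β s).1) (β t).2 t :=
    (hJβ t ht).fst
  have hv (t) (ht : t ∈ J) : HasDerivAt (fun s ↦ (β s).2)
      (- ∑ i, ∑ j, (c i (β t).2 * c j (β t).2) • γ i j (β t).1) t :=
    (hJβ t ht).snd
  have hx2 : ContDiffOn ℝ 2 (fun s ↦ (β s).1) J := by
    rw [show (2 : ℕ∞ω) = 1 + 1 by norm_num, contDiffOn_succ_iff_deriv_of_isOpen hJ]
    refine ⟨fun t ht ↦ (hx t ht).differentiableAt.differentiableWithinAt, by simp, ?_⟩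
    exact (contDiff_snd.comp_contDiffOn hβ1).congr fun t ht ↦ (hx t ht).deriv
  let α : ℝ → M := fun s ↦ ψ.symm (β s).1
  have hα2 : ContMDiffOn 𝓘(ℝ, ℝ) 𝓘(ℝ, E) 2 α J :=
    ((contMDiffOn_extChartAt_symm (n := 2) p)).comp hx2.contMDiffOn fun t ht ↦ (hJg t ht).2.1
  have hαd (t) (ht : t ∈ J) : MDifferentiableAt 𝓘(ℝ, ℝ) 𝓘(ℝ, E) α t :=
    (hα2.contMDiffAt (hJ.mem_nhds ht)).mdifferentiableAt (by simp)
  have hvel (t) (ht : t ∈ J) : (e ⟨α t, velocity E α t⟩).2 = (β t).2 := by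
    rw [trivializationAt_velocity (hαd t ht) (hJg t ht).2.2.1, ← (hx t ht).deriv]
    refine EventuallyEq.deriv_eq ?_
    filter_upwards [hJ.mem_nhds ht] with s hs
    exact ψ.right_inv (hJg s hs).2.1
  have hsum (t) (ht : t ∈ J) : velocity E α t = ∑ i, c i (β t).2 • F i (α t) := by
    simp_rw [← hvel t ht]
    exact (hJg t ht).2.2.2 _
  refine ⟨α, J, ⟨hJ, Set.ordConnected_Ioo, hα2, fun t ht ↦ ?_⟩, h0J, ?_⟩
  · have hw (i) : HasDerivAt (fun s ↦ c i (β s).2) _ t := (c i).hasFDerivAt.comp_hasDerivAt t (hv t ht)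
    rw [covDerivAlong_sum (hαd t ht) (fun i ↦ (hF i).mdiffAt _)
      (fun i ↦ (hw i).differentiableAt) ((hJ.eventually_mem ht).mono fun s hs ↦ hsum s hs)]
    simp_rw [(hw _).deriv]
    have h1 (j) : leviCivita E M (F j) (α t) (velocity E α t)
        = ∑ i, c i (β t).2 • Γ i j (α t) := by
      rw [hsum t ht, map_sum]
      exact Finset.sum_congr rfl fun i _ ↦ map_smul _ _ _
    let R : E →ₗ[ℝ] TangentSpace 𝓘(ℝ, E) (α t) :=
      ∑ k, (c k : E →ₗ[ℝ] ℝ).smulRight (F k (α t))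
    have hR (y : E) : ∑ k, c k y • F k (α t) = R y := by
      simp [R, LinearMap.sum_apply]
    have hRγ (i j) : R (γ i j (β t).1) = Γ i j (α t) :=
      (hR _).symm.trans ((hJg t ht).2.2.2 _).symm
    simp_rw [h1, Finset.sum_add_distrib, hR, map_neg, map_sum, map_smul, hRγ, Finset.smul_sum,
      smul_smul]
    rw [Finset.sum_comm, neg_add_eq_zero]
    exact Finset.sum_congr rfl fun j _ ↦ Finset.sum_congr rfl fun i _ ↦ by rw [mul_comm]
  · have hα0 : α 0 = p := by
      change ψ.symm (β 0).1 = p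
      rw [hβ0]
      exact extChartAt_to_inv p
    have hp : p ∈ e.baseSet := FiberBundle.mem_baseSet_trivializationAt' p
    have hs1 : (⟨α 0, velocity E α 0⟩ : TotalSpace E (TangentSpace 𝓘(ℝ, E) : M → Type _))
      ∈ e.source := e.mem_source.mpr (by rw [hα0]; exact hp)
    refine e.injOn hs1 (e.mem_source.mpr hp) (Prod.ext ?_ ?_)
    · have hs2 : (⟨p, u⟩ : TotalSpace E (TangentSpace 𝓘(ℝ, E) : M → Type _)) ∈ e.source :=
        e.mem_source.mpr hp
      exact (e.coe_fst hs1).trans (hα0.trans (e.coe_fst hs2).symm)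
    · exact (hvel 0 h0J).trans (by rw [hβ0]; rfl)

end GeodesicExistence

/-! ### Clairaut's relation along geodesics -/

section Clairaut

open Filter Topology

variable {E : Type*} [NormedAddCommGroup E] [NormedSpace ℝ E] [FiniteDimensional ℝ E]
  {M : Type*} [TopologicalSpace M] [ChartedSpace E M] [IsManifold 𝓘(ℝ, E) ∞ M]
  [RiemannianBundle (fun x : M ↦ TangentSpace 𝓘(ℝ, E) x)]
  {E' : Type*} [NormedAddCommGroup E'] [NormedSpace ℝ E']
  {N : Type*} [TopologicalSpace N] [ChartedSpace E' N]

theorem inner_grad (f : M → ℝ) (p : M) (v : TangentSpace 𝓘(ℝ, E) p) :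
    inner ℝ (grad f p) v = mvfderiv 𝓘(ℝ, E) f p v :=
  InnerProductSpace.toDual_symm_apply

theorem norm_vert_sq (proj : M → N) (p : M) (u : TangentSpace 𝓘(ℝ, E) p) :
    ‖vert E E' proj p u‖ ^ 2 = inner ℝ (vert E E' proj p u) u := by
  rw [← real_inner_self_eq_norm_sq, inner_vert_left,
    inner_vert_left, vert_eq_self (vert_mem proj p u), real_inner_comm]

theorem sin_horizontalAngle_sq_mul (proj : M → N) (p : M) (u : TangentSpace 𝓘(ℝ, E) p) :
    Real.sin (horizontalAngle E E' proj p u) ^ 2 * inner ℝ u u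
      = inner ℝ (vert E E' proj p u) u := by
  have h1 : inner ℝ u (hor E E' proj p u) = ‖hor E E' proj p u‖ ^ 2 := by
    rw [← real_inner_self_eq_norm_sq, inner_hor_left, hor_eq_self (hor_mem proj p u)]
  have h2 : inner ℝ u u = (inner ℝ (vert E E' proj p u) u : ℝ) + ‖hor E E' proj p u‖ ^ 2 := by
    rw [← h1, real_inner_comm (hor E E' proj p u) u, ← inner_add_left, vert_add_hor]
  have h3 : Real.cos (horizontalAngle E E' proj p u) * ‖u‖ = ‖hor E E' proj p u‖ := by
    have h4 := InnerProductGeometry.cos_angle_mul_norm_mul_norm u (hor E E' proj p u)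
    rcases eq_or_ne (hor E E' proj p u) 0 with h0 | h0
    · simp [horizontalAngle, h0]
    · refine mul_right_cancel₀ (norm_ne_zero_iff.mpr h0) ?_
      rw [mul_assoc, horizontalAngle, h4, h1, sq]
  have h5 := Real.sin_sq_add_cos_sq (horizontalAngle E E' proj p u)
  have h6 : Real.sin (horizontalAngle E E' proj p u) ^ 2
      = 1 - Real.cos (horizontalAngle E E' proj p u) ^ 2 := by linarith
  have h7 : Real.cos (horizontalAngle E E' proj p u) ^ 2 * inner ℝ u u
      = ‖hor E E' proj p u‖ ^ 2 := by
    rw [real_inner_self_eq_norm_sq, ← mul_pow, h3]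
  rw [h6, sub_mul, h7, one_mul]
  linarith

variable [IsContMDiffRiemannianBundle 𝓘(ℝ, E) ∞ E (fun x : M ↦ TangentSpace 𝓘(ℝ, E) x)]
  [T2Space M] [FiniteDimensional ℝ E'] [IsManifold 𝓘(ℝ, E') ∞ N]
  [RiemannianBundle (fun x : N ↦ TangentSpace 𝓘(ℝ, E') x)]
  [IsContMDiffRiemannianBundle 𝓘(ℝ, E') ∞ E' (fun x : N ↦ TangentSpace 𝓘(ℝ, E') x)]
  {proj : M → N} {f : M → ℝ} {α : ℝ → M} {J : Set ℝ}

/-- The derivative along a geodesic of `e^{2f} ‖𝒱 α̇‖²`, which is `(e^f sin θ)²` times the constant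
`‖α̇‖²`. -/
theorem hasDerivAt_exp_mul_vert (h : IsRiemannianSubmersion E E' proj)
    (hf : ContMDiff 𝓘(ℝ, E) 𝓘(ℝ, ℝ) ∞ f) (hα : IsGeodesicOn E α J) {t : ℝ} (ht : t ∈ J) :
    HasDerivAt (fun s ↦ Real.exp (f (α s)) ^ 2 *
        inner ℝ (vert E E' proj (α s) (velocity E α s)) (velocity E α s))
      (Real.exp (f (α t)) ^ 2 * (2 * (mvfderiv 𝓘(ℝ, E) f (α t) (velocity E α t) *
          ‖vert E E' proj (α t) (velocity E α t)‖ ^ 2)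
        + inner ℝ (covEndo h.isSmoothEndo_vert (α t) (velocity E α t) (velocity E α t))
          (velocity E α t))) t := by
  have h1 := hasDerivAt_comp_curve ((hf (α t)).mdifferentiableAt (by simp))
    (hα.mdifferentiableAt ht)
  refine ((h1.exp.pow 2).mul (hα.hasDerivAt_inner_endo ht h.isSmoothEndo_vert)).congr_deriv ?_
  rw [norm_vert_sq]
  simp
  ring

/-- On an open interval, a function with vanishing derivative is constant. -/
theorem eq_of_hasDerivAt_zero (hJ : IsOpen J) (hJ' : J.OrdConnected) {k : ℝ → ℝ}
    (hk : ∀ t ∈ J, HasDerivAt k 0 t) {s t : ℝ} (hs : s ∈ J) (ht : t ∈ J) : k s = k t :=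
  hJ.is_const_of_deriv_eq_zero hJ'.isPreconnected
    (fun t ht ↦ (hk t ht).differentiableAt.differentiableWithinAt) (fun t ht ↦ (hk t ht).deriv) hs ht

/-- Clairaut's relation along a geodesic in infinitesimal form. -/
theorem clairaut_along_iff (h : IsRiemannianSubmersion E E' proj)
    (hf : ContMDiff 𝓘(ℝ, E) 𝓘(ℝ, ℝ) ∞ f) (hα : IsGeodesicOn E α J) :
    (∃ c : ℝ, ∀ t ∈ J, Real.exp (f (α t)) *
        Real.sin (horizontalAngle E E' proj (α t) (velocity E α t)) = c) ↔
      ∀ t ∈ J, mvfderiv 𝓘(ℝ, E) f (α t) (velocity E α t) *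
          ‖vert E E' proj (α t) (velocity E α t)‖ ^ 2
        = - (1 / 2) * inner ℝ (covEndo h.isSmoothEndo_vert (α t) (velocity E α t) (velocity E α t))
          (velocity E α t) := by
  have hsq (t) : (Real.exp (f (α t)) *
      Real.sin (horizontalAngle E E' proj (α t) (velocity E α t))) ^ 2
        * inner ℝ (velocity E α t) (velocity E α t)
      = Real.exp (f (α t)) ^ 2 *
        inner ℝ (vert E E' proj (α t) (velocity E α t)) (velocity E α t) := by
    rw [mul_pow, mul_assoc, sin_horizontalAngle_sq_mul]
  constructor
  · rintro ⟨c, hc⟩ t ht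
    have h1 := hasDerivAt_exp_mul_vert h hf hα ht
    have h2 := ((hα.hasDerivAt_norm_sq ht).const_mul (c ^ 2)).congr_of_eventuallyEq
      (f₁ := fun s ↦ Real.exp (f (α s)) ^ 2 *
        (inner ℝ (vert E E' proj (α s) (velocity E α s)) (velocity E α s) : ℝ)) (by
        filter_upwards [hα.isOpen.mem_nhds ht] with s hs
        rw [← hsq, hc s hs])
    have h3 := h1.unique h2
    have h4 := mul_eq_zero.mp (h3.trans (mul_zero _))
    have h5 := h4.resolve_left (pow_ne_zero _ (Real.exp_pos _).ne')
    linarith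
  · intro hd
    rcases J.eq_empty_or_nonempty with rfl | ⟨t₀, ht₀⟩
    · exact ⟨0, by simp⟩
    refine ⟨Real.exp (f (α t₀)) *
      Real.sin (horizontalAngle E E' proj (α t₀) (velocity E α t₀)), fun t ht ↦ ?_⟩
    have hN := eq_of_hasDerivAt_zero hα.isOpen hα.ordConnected (fun t ht ↦ hα.hasDerivAt_norm_sq ht) ht ht₀
    rcases eq_or_ne (inner ℝ (velocity E α t₀) (velocity E α t₀) : ℝ) 0 with h0 | h0
    · -- a constant geodesic, for which the angle is `π / 2` by convention
      have hv (s) (hs : s ∈ J) : velocity E α s = 0 := inner_self_eq_zero.mp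
        ((eq_of_hasDerivAt_zero hα.isOpen hα.ordConnected (fun t ht ↦ hα.hasDerivAt_norm_sq ht) hs ht₀).trans h0)
      have hfc := eq_of_hasDerivAt_zero hα.isOpen hα.ordConnected (k := fun s ↦ f (α s)) (fun s hs ↦ by
        have h1 := hasDerivAt_comp_curve ((hf (α s)).mdifferentiableAt (by simp))
          (hα.mdifferentiableAt hs)
        rwa [hv s hs, map_zero] at h1) ht ht₀
      have hfc' : f (α t) = f (α t₀) := hfc
      rw [hfc', hv t ht, hv t₀ ht₀]
      simp [horizontalAngle]
    · have hK := eq_of_hasDerivAt_zero hα.isOpen hα.ordConnected (fun s hs ↦ (hasDerivAt_exp_mul_vert h hf hα hs).congr_deriv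
        (by rw [hd s hs]; ring)) ht ht₀
      have h1 := (hsq t).trans (Eq.trans hK (hsq t₀).symm)
      have hN' : (inner ℝ (velocity E α t) (velocity E α t) : ℝ)
        = inner ℝ (velocity E α t₀) (velocity E α t₀) := hN
      rw [hN'] at h1
      have nonneg (s) : 0 ≤ Real.exp (f (α s)) *
          Real.sin (horizontalAngle E E' proj (α s) (velocity E α s)) :=
        mul_nonneg (Real.exp_pos _).le (InnerProductGeometry.sin_angle_nonneg _ _)
      exact (pow_left_inj₀ (nonneg t) (nonneg t₀) two_ne_zero).mp (mul_right_cancel₀ h0 h1)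

/-- A condition on tangent vectors holds everywhere if it holds for the velocities of geodesics. -/
theorem forall_tangent_of_forall_geodesic {Q : ∀ p : M, TangentSpace 𝓘(ℝ, E) p → Prop}
    (hQ : ∀ (α : ℝ → M) (J : Set ℝ), IsGeodesicOn E α J → ∀ t ∈ J, Q (α t) (velocity E α t))
    (p : M) (u : TangentSpace 𝓘(ℝ, E) p) : Q p u := by
  obtain ⟨α, J, hα, h0, heq⟩ := exists_geodesic p u
  let Q' : TotalSpace E (TangentSpace 𝓘(ℝ, E) : M → Type _) → Prop := fun z ↦ Q z.1 z.2
  have h1 : Q' ⟨α 0, velocity E α 0⟩ := hQ α J hα 0 h0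
  rw [heq] at h1
  exact h1

/-- If `f` is constant in vertical directions, then `df` only sees the horizontal part. -/
theorem mvfderiv_eq_mvfderiv_hor {p : M}
    (hv : ∀ v ∈ verticalSpace E E' proj p, mvfderiv 𝓘(ℝ, E) f p v = 0)
    (u : TangentSpace 𝓘(ℝ, E) p) :
    mvfderiv 𝓘(ℝ, E) f p u = mvfderiv 𝓘(ℝ, E) f p (hor E E' proj p u) := by
  conv_lhs => rw [← vert_add_hor (E' := E') proj p u, map_add, hv _ (vert_mem proj p u), zero_add]

end Clairaut

end ClairautSubmersion

end

open ClairautSubmersion in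
theorem mainTheorem1
    {E : Type*} [NormedAddCommGroup E] [NormedSpace ℝ E] [FiniteDimensional ℝ E]
    {M : Type*} [TopologicalSpace M] [T2Space M] [SecondCountableTopology M]
    [ChartedSpace E M] [IsManifold 𝓘(ℝ, E) ∞ M]
    [RiemannianBundle (fun x : M ↦ TangentSpace 𝓘(ℝ, E) x)]
    [IsContMDiffRiemannianBundle 𝓘(ℝ, E) ∞ E (fun x : M ↦ TangentSpace 𝓘(ℝ, E) x)]
    {E' : Type*} [NormedAddCommGroup E'] [NormedSpace ℝ E'] [FiniteDimensional ℝ E']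
    {N : Type*} [TopologicalSpace N] [T2Space N] [SecondCountableTopology N]
    [ChartedSpace E' N] [IsManifold 𝓘(ℝ, E') ∞ N]
    [RiemannianBundle (fun x : N ↦ TangentSpace 𝓘(ℝ, E') x)]
    [IsContMDiffRiemannianBundle 𝓘(ℝ, E') ∞ E' (fun x : N ↦ TangentSpace 𝓘(ℝ, E') x)]
    (φ : Π x : M, TangentSpace 𝓘(ℝ, E) x →L[ℝ] TangentSpace 𝓘(ℝ, E) x)
    (ξ : Π x : M, TangentSpace 𝓘(ℝ, E) x)
    (η : Π x : M, TangentSpace 𝓘(ℝ, E) x →L[ℝ] ℝ)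
    (hS : IsSasakian φ ξ η)
    (proj : M → N) (hproj : IsAntiInvariantSubmersion E E' φ proj)
    (hξ : ∀ p, ξ p ∈ horizontalSpace E E' proj p)
    (f : M → ℝ) (hf : ContMDiff 𝓘(ℝ, E) 𝓘(ℝ, ℝ) ∞ f) :
    IsClairautWith E E' proj (fun p ↦ Real.exp (f p)) ↔
      ∀ (α : ℝ → M) (J : Set ℝ), IsGeodesicOn E α J → ∀ t ∈ J,
        -- the vertical and horizontal parts of the velocity, `φX = ℬX + 𝒞X`
        let V : Π s, TangentSpace 𝓘(ℝ, E) (α s) := fun s ↦ vert E E' proj (α s) (velocity E α s)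
        let X : Π s, TangentSpace 𝓘(ℝ, E) (α s) := fun s ↦ hor E E' proj (α s) (velocity E α s)
        let BX : Π s, TangentSpace 𝓘(ℝ, E) (α s) := fun s ↦ vert E E' proj (α s) (φ (α s) (X s))
        let CX : Π s, TangentSpace 𝓘(ℝ, E) (α s) := fun s ↦ hor E E' proj (α s) (φ (α s) (X s))
        inner ℝ (grad f (α t)) (X t) * ‖V t‖ ^ 2
          = inner ℝ
              (η (α t) (X t) • X t + hor E E' proj (α t) (covDerivAlong α CX t)
                + (oneillT E E' proj (α t) (V t) (BX t) + oneillA E E' proj (α t) (X t) (BX t)))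
              (φ (α t) (V t)) := by
  have h := hproj.toIsRiemannianSubmersion
  -- both conditions are conditions on single tangent vectors, as every one is tangent to a geodesic
  have hRHS (α : ℝ → M) (J : Set ℝ) (hα : IsGeodesicOn E α J) (t : ℝ) (ht : t ∈ J) :
      inner ℝ
        (η (α t) (hor E E' proj (α t) (velocity E α t)) • hor E E' proj (α t) (velocity E α t)
          + hor E E' proj (α t) (covDerivAlong α (fun s ↦ hor E E' proj (α s) (φ (α s)
            (hor E E' proj (α s) (velocity E α s)))) t)
          + (oneillT E E' proj (α t) (vert E E' proj (α t) (velocity E α t))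
              (vert E E' proj (α t) (φ (α t) (hor E E' proj (α t) (velocity E α t))))
            + oneillA E E' proj (α t) (hor E E' proj (α t) (velocity E α t))
              (vert E E' proj (α t) (φ (α t) (hor E E' proj (α t) (velocity E α t))))))
        (φ (α t) (vert E E' proj (α t) (velocity E α t)))
      = - (1 / 2) * inner ℝ (covEndo h.isSmoothEndo_vert (α t) (velocity E α t) (velocity E α t))
          (velocity E α t) := by
    rw [← clairaut_rhs_eq hS hproj hξ,
      ← hα.covDerivAlong_endo ht (h.isSmoothEndo_hor.comp (hS.isSmoothEndo.comp h.isSmoothEndo_hor))]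
    rfl
  constructor
  · intro hC
    have hall := forall_tangent_of_forall_geodesic (Q := fun p u ↦
      mvfderiv 𝓘(ℝ, E) f p u * ‖vert E E' proj p u‖ ^ 2
        = - (1 / 2) * inner ℝ (covEndo h.isSmoothEndo_vert p u u) u)
      fun α J hα ↦ (clairaut_along_iff h hf hα).mp (hC.constant α J hα)
    have hv (p : M) (v) (hv : v ∈ verticalSpace E E' proj p) : mvfderiv 𝓘(ℝ, E) f p v = 0 := by
      rcases eq_or_ne v 0 with rfl | hv0
      · exact map_zero _
      have h1 := hall p v
      rw [h.inner_covEndo_self, hor_eq_zero hv, inner_zero_right, mul_zero, mul_zero,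
        vert_eq_self hv] at h1
      exact (mul_eq_zero.mp h1).resolve_right (pow_ne_zero _ (norm_ne_zero_iff.mpr hv0))
    intro α J hα t ht V X BX CX
    rw [inner_grad, ← mvfderiv_eq_mvfderiv_hor (hv (α t))]
    exact (hall (α t) (velocity E α t)).trans (hRHS α J hα t ht).symm
  · intro hA
    have hall := forall_tangent_of_forall_geodesic (Q := fun p u ↦
      mvfderiv 𝓘(ℝ, E) f p (hor E E' proj p u) * ‖vert E E' proj p u‖ ^ 2
        = - (1 / 2) * inner ℝ (covEndo h.isSmoothEndo_vert p u u) u)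
      fun α J hα t ht ↦ by
        rw [← inner_grad]
        exact (hA α J hα t ht).trans (hRHS α J hα t ht)
    refine ⟨h, fun p ↦ Real.exp_pos _, fun α J hα ↦
      (clairaut_along_iff h hf hα).mpr fun t ht ↦ ?_⟩
    rw [mvfderiv_eq_mvfderiv_hor (fun v hv ↦ mvfderiv_vertical_of_clairaut hS hproj hξ hall hf hv)]
    exact hall (α t) (velocity E α t)
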